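/- Let $k$ be a commutative ring. A commutative trialgebra is a $k$-module with two binary (bilinear) operations $*$ and $\bullet$ such that $$(x*y)*z=x*(y*z)=x*(z*y),\quad x\bullet y=y\bullet x,\quad (x\bullet y)\bullet z=x\bullet(y\bullet z),\quad x*(y\bullet z)=x*(y*z),\quad (x\bullet y)*z=x\bullet(y*z).$$ Let $\mathcal{C}om\mathcal{T}rias$ be the algebraic (symmetric) operad over $k$ coding commutative trialgebras, i.e. the quotient of the free operad on two binary operations $*$, $\bullet$ by the operadic ideal generated by these relations. (Operads have arities $n\ge 1$. The symmetric group $\mathbb{S}_n$ acts by relabelling inputs; written as a left action, $\sigma$ acts as $p\mapsto p^{\sigma^{-1}}$ for the usual right action.) For $n\ge 1$ let $\mathcal{C}om\mathcal{T}rias_n=\{e^n_J : \emptyset\neq J\subseteq[n]\}$, where $[n]=\{1,\dots,n\}$. **Theorem.** There are isomorphisms of $k$-modules $\mathcal{C}om\mathcal{T}rias(n)\cong k[\mathcal{C}om\mathcal{T}rias_n]$, $n\ge1$, sending $*$ to $e^2_{\{1\}}$ and $\bullet$ to $e^2_{\{1,2\}}$, under which $\mathbb{S}_n$ acts by its natural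 action on subsets, $\sigma\cdot e^n_J=e^n_{\sigma(J)}$, the operadic unit is $e^1_{\{1\}}$, and the operadic composition is $$e^t_J\circ\bigl(e^{i_1}_{J_1},\dots,e^{i_t}_{J_t}\bigr)=e^{n}_{\bar J},\qquad n=i_1+\cdots+i_t,\qquad \bar J=\bigcup_{j\in J}\{\,i_1+\cdots+i_{j-1}+a : a\in J_j\,\}.$$ Thus the sets $\mathcal{C}om\mathcal{T}rias_n$ form a set operad whose linearization is isomorphic, as an operad, to $\mathcal{C}om\mathcal{T}rias$. Consequently $\mathcal{C}om\mathcal{T}rias$ is a basic-set operad: for all nonempty $J_1\subseteq[i_1],\dots,J_t\subseteq[i_t]$ the map $$\mathcal{C}om\mathcal{T}rias_t\to\mathcal{C}om\mathcal{T}rias_{i_1+\cdots+i_t},\qquad e^t_J\mapsto e^t_J\circ\bigl(e^{i_1}_{J_1},\dots,e^{i_t}_{J_t}\bigr)$$ is injective. -/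

import Mathlib

universe u v w

noncomputable section

/-! ### Blocks of ordinals

`finSigmaFinEquiv : (Σ j : Fin t, Fin (i j)) ≃ Fin (∑ j, i j)` is the order-preserving
identification `(j, a) ↦ i 0 + ⋯ + i (j - 1) + a` (everything is indexed from `0`). -/

/-- Value of `finSigmaFinEquiv`: the element `a` of the `j`-th block is `i 0 + ⋯ + i (j-1) + a`. -/
theorem val_finSigmaFinEquiv {t : ℕ} {i : Fin t → ℕ} (j : Fin t) (a : Fin (i j)) :
    (finSigmaFinEquiv ⟨j, a⟩ : ℕ) = ∑ l ∈ Finset.univ.filter (· < j), i l + a := by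
  rw [finSigmaFinEquiv_apply]
  congr 1
  refine Finset.sum_bij' (fun x _ => Fin.castLE j.2.le x)
    (fun l hl => ⟨l, by simpa using hl⟩) ?_ ?_ ?_ ?_ ?_
  · intro x _
    simpa using Fin.lt_def.2 x.2
  · intros; simp
  · intros; rfl
  · intros; rfl
  · intros; rfl

theorem finSigmaFinEquiv_lt {t : ℕ} {i : Fin t → ℕ} {j j' : Fin t}
    (h : j < j') (a : Fin (i j)) (a' : Fin (i j')) :
    finSigmaFinEquiv ⟨j, a⟩ < (finSigmaFinEquiv ⟨j', a'⟩ : Fin (∑ j, i j)) := by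
  rw [Fin.lt_def, val_finSigmaFinEquiv, val_finSigmaFinEquiv]
  have h1 : ∑ l ∈ insert j (Finset.univ.filter (· < j)), i l
      ≤ ∑ l ∈ Finset.univ.filter (· < j'), i l := by
    apply Finset.sum_le_sum_of_subset
    intro l hl
    simp only [Finset.mem_insert, Finset.mem_filter, Finset.mem_univ, true_and] at hl ⊢
    rcases hl with rfl | hl
    · exact h
    · exact hl.trans h
  rw [Finset.sum_insert (by simp)] at h1
  have := a.2
  omega

theorem finSigmaFinEquiv_lt_right {t : ℕ} {i : Fin t → ℕ} {j : Fin t}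
    {a a' : Fin (i j)} (h : a < a') :
    finSigmaFinEquiv ⟨j, a⟩ < (finSigmaFinEquiv ⟨j, a'⟩ : Fin (∑ j, i j)) := by
  rw [Fin.lt_def, val_finSigmaFinEquiv, val_finSigmaFinEquiv]
  have := Fin.lt_def.1 h
  omega

/-- The arities `m j l`, listed in lexicographic order of the pairs `(j, l)`. -/
abbrev nestedArity {t : ℕ} {i : Fin t → ℕ} (m : ∀ j, Fin (i j) → ℕ) (a : Fin (∑ j, i j)) : ℕ :=
  m (finSigmaFinEquiv.symm a).1 (finSigmaFinEquiv.symm a).2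

theorem sum_nestedArity {t : ℕ} {i : Fin t → ℕ} (m : ∀ j, Fin (i j) → ℕ) :
    ∑ a, nestedArity m a = ∑ j, ∑ l, m j l := by
  unfold nestedArity
  rw [Equiv.sum_comp finSigmaFinEquiv.symm
    (fun s : (Σ j : Fin t, Fin (i j)) => m s.1 s.2), Fintype.sum_sigma]

/-- Grouping nested blocks in one step or in two steps gives the same positions. -/
theorem finSigmaFinEquiv_assoc {t : ℕ} {i : Fin t → ℕ} (m : ∀ j, Fin (i j) → ℕ)
    (a : Fin (∑ j, i j)) (x : Fin (nestedArity m a)) :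
    finCongr (sum_nestedArity m) (finSigmaFinEquiv ⟨a, x⟩) =
      (finSigmaFinEquiv ⟨(finSigmaFinEquiv.symm a).1,
        finSigmaFinEquiv ⟨(finSigmaFinEquiv.symm a).2, x⟩⟩ : Fin (∑ j, ∑ l, m j l)) := by
  let F : Fin (∑ a, nestedArity m a) → Fin (∑ j, ∑ l, m j l) := fun y =>
    let s := finSigmaFinEquiv.symm y
    (finSigmaFinEquiv ⟨(finSigmaFinEquiv.symm s.1).1,
        finSigmaFinEquiv ⟨(finSigmaFinEquiv.symm s.1).2, s.2⟩⟩ : Fin (∑ j, ∑ l, m j l))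
  have hFa : ∀ (b : Fin (∑ j, i j)) (z : Fin (nestedArity m b)), F (finSigmaFinEquiv ⟨b, z⟩) =
      (finSigmaFinEquiv ⟨(finSigmaFinEquiv.symm b).1,
        finSigmaFinEquiv ⟨(finSigmaFinEquiv.symm b).2, z⟩⟩ : Fin (∑ j, ∑ l, m j l)) := by
    intro b z
    have key : ∀ s : (Σ b : Fin (∑ j, i j), Fin (nestedArity m b)), s = ⟨b, z⟩ →
      (finSigmaFinEquiv ⟨(finSigmaFinEquiv.symm s.1).1,
        finSigmaFinEquiv ⟨(finSigmaFinEquiv.symm s.1).2, s.2⟩⟩ : Fin (∑ j, ∑ l, m j l)) =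
      (finSigmaFinEquiv ⟨(finSigmaFinEquiv.symm b).1,
        finSigmaFinEquiv ⟨(finSigmaFinEquiv.symm b).2, z⟩⟩ : Fin (∑ j, ∑ l, m j l)) := by
      rintro _ rfl
      rfl
    exact key _ (Equiv.symm_apply_apply _ _)
  have hF : StrictMono F := by
    intro y y' hy
    obtain ⟨⟨b, z⟩, rfl⟩ := finSigmaFinEquiv.surjective y
    obtain ⟨⟨b', z'⟩, rfl⟩ := finSigmaFinEquiv.surjective y'
    rw [hFa, hFa]
    rcases lt_trichotomy b b' with hb | hb | hb
    · obtain ⟨⟨c, d⟩, rfl⟩ := finSigmaFinEquiv.surjective b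
      obtain ⟨⟨c', d'⟩, rfl⟩ := finSigmaFinEquiv.surjective b'
      have hcd : c < c' ∨ ∃ h : c = c', d < h ▸ d' := by
        rcases lt_trichotomy c c' with hc | rfl | hc
        · exact Or.inl hc
        · refine Or.inr ⟨rfl, ?_⟩
          by_contra hd
          rcases lt_or_eq_of_le (not_lt.1 hd) with hd | hd
          · exact lt_asymm hb (finSigmaFinEquiv_lt_right hd)
          · simp only at hd
            subst hd
            exact lt_irrefl _ hb
        · exact absurd hb (lt_asymm (finSigmaFinEquiv_lt hc _ _))
      rcases hcd with hc | ⟨rfl, hd⟩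
      · apply finSigmaFinEquiv_lt
        simpa using hc
      · have key : ∀ (p p' : Σ j : Fin t, Fin (i j)), p = ⟨c, d⟩ → p' = ⟨c, d'⟩ →
            ∀ (z : Fin (m p.1 p.2)) (z' : Fin (m p'.1 p'.2)),
            (finSigmaFinEquiv ⟨p.1, finSigmaFinEquiv ⟨p.2, z⟩⟩ : Fin (∑ j, ∑ l, m j l)) <
            finSigmaFinEquiv ⟨p'.1, finSigmaFinEquiv ⟨p'.2, z'⟩⟩ := by
          rintro _ _ rfl rfl z z'
          exact finSigmaFinEquiv_lt_right (finSigmaFinEquiv_lt hd _ _)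
        exact key _ _ (Equiv.symm_apply_apply _ _) (Equiv.symm_apply_apply _ _) z z'
    · subst hb
      apply finSigmaFinEquiv_lt_right
      apply finSigmaFinEquiv_lt_right
      by_contra hz
      rcases lt_or_eq_of_le (not_lt.1 hz) with hz | hz
      · exact lt_asymm hy (finSigmaFinEquiv_lt_right hz)
      · subst hz
        exact lt_irrefl _ hy
    · exact absurd hy (lt_asymm (finSigmaFinEquiv_lt hb _ _))
  have hFb : Function.Bijective F := by
    rw [Fintype.bijective_iff_injective_and_card]
    exact ⟨hF.injective, by simp [sum_nestedArity]⟩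
  have h : hF.orderIsoOfSurjective F hFb.2 = Fin.castOrderIso (sum_nestedArity m) :=
    Subsingleton.elim _ _
  have h2 := congrArg (fun e => e (finSigmaFinEquiv ⟨a, x⟩)) h
  simp only [StrictMono.coe_orderIsoOfSurjective] at h2
  rw [hFa] at h2
  exact h2.symm

/-- Block permutation: `σ` permutes the blocks, and is order-preserving inside the blocks. -/
def blockEquiv {s t : ℕ} (σ : Fin s ≃ Fin t) (i : Fin t → ℕ) :
    Fin (∑ j, i (σ j)) ≃ Fin (∑ j, i j) :=
  finSigmaFinEquiv.symm.trans
    ((Equiv.sigmaCongrLeft (β := fun j => Fin (i j)) σ).trans finSigmaFinEquiv)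

/-- Direct sum of permutations: every block is permuted by its own `τ j`. -/
def sumEquiv {t : ℕ} {i i' : Fin t → ℕ} (τ : ∀ j, Fin (i j) ≃ Fin (i' j)) :
    Fin (∑ j, i j) ≃ Fin (∑ j, i' j) :=
  finSigmaFinEquiv.symm.trans ((Equiv.sigmaCongrRight τ).trans finSigmaFinEquiv)

theorem blockEquiv_apply {s t : ℕ} (σ : Fin s ≃ Fin t) (i : Fin t → ℕ) (j : Fin s)
    (a : Fin (i (σ j))) :
    blockEquiv σ i (finSigmaFinEquiv ⟨j, a⟩) = finSigmaFinEquiv ⟨σ j, a⟩ := by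
  simp [blockEquiv]

theorem sumEquiv_apply {t : ℕ} {i i' : Fin t → ℕ} (τ : ∀ j, Fin (i j) ≃ Fin (i' j)) (j : Fin t)
    (a : Fin (i j)) :
    sumEquiv τ (finSigmaFinEquiv ⟨j, a⟩) = finSigmaFinEquiv ⟨j, τ j a⟩ := by
  simp [sumEquiv]

theorem sum_fin_one_const (n : ℕ) : (∑ _j : Fin 1, n) = n := by simp

theorem sum_fin_const_one (n : ℕ) : (∑ _j : Fin n, 1) = n := by simp

theorem finCongr_one_block (n : ℕ) (a : Fin n) :
    finCongr (sum_fin_one_const n) (finSigmaFinEquiv ⟨(0 : Fin 1), a⟩) = a := by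
  apply Fin.ext
  simp

theorem finCongr_unit_blocks (n : ℕ) (j : Fin n) (a : Fin 1) :
    finCongr (sum_fin_const_one n) (finSigmaFinEquiv ⟨j, a⟩) = j := by
  apply Fin.ext
  simp [Fin.fin_one_eq_zero a]

/-! ### Operads

Operads have arities `n ≥ 1`; the value in arity `0` is therefore required to be empty
(set operads) or zero (algebraic operads).

The action of the symmetric groups is recorded as relabelling of the inputs along bijections
`Fin m ≃ Fin n` (such a bijection forces `m = n`, so this is an action of `Equiv.Perm (Fin n)` on
the `n`-th term together with the transport along equalities of arities). The right action of the
literature is `p ^ σ = map σ⁻¹ p`. -/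

/-- A (symmetric) set operad. -/
structure SetOperad where
  /-- operations of arity `n` -/
  obj : ℕ → Type v
  isEmpty_zero : IsEmpty (obj 0)
  /-- relabelling of the inputs -/
  map : ∀ {m n : ℕ}, (Fin m ≃ Fin n) → obj m → obj n
  map_refl : ∀ {n : ℕ} (p : obj n), map (Equiv.refl (Fin n)) p = p
  map_trans : ∀ {l m n : ℕ} (σ : Fin l ≃ Fin m) (τ : Fin m ≃ Fin n) (p : obj l),
    map (σ.trans τ) p = map τ (map σ p)
  /-- the unit -/
  one : obj 1
  /-- the composition `p ∘ (q_1, …, q_t)` -/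
  comp : ∀ {t : ℕ} (i : Fin t → ℕ), obj t → (∀ j, obj (i j)) → obj (∑ j, i j)
  one_comp : ∀ {n : ℕ} (p : obj n),
    map (finCongr (sum_fin_one_const n)) (comp (fun _ : Fin 1 => n) one (fun _ => p)) = p
  comp_one : ∀ {n : ℕ} (p : obj n),
    map (finCongr (sum_fin_const_one n)) (comp (fun _ : Fin n => 1) p (fun _ => one)) = p
  comp_assoc : ∀ {t : ℕ} (i : Fin t → ℕ) (m : ∀ j, Fin (i j) → ℕ) (p : obj t)
    (q : ∀ j, obj (i j)) (r : ∀ j l, obj (m j l)),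
    map (finCongr (sum_nestedArity m)) (comp (nestedArity m) (comp i p q)
      (fun a => r (finSigmaFinEquiv.symm a).1 (finSigmaFinEquiv.symm a).2)) =
    comp (fun j => ∑ l, m j l) p (fun j => comp (m j) (q j) (r j))
  comp_map_left : ∀ {s t : ℕ} (σ : Fin s ≃ Fin t) (i : Fin t → ℕ) (p : obj s)
    (q : ∀ j, obj (i j)),
    comp i (map σ p) q = map (blockEquiv σ i) (comp (fun j => i (σ j)) p (fun j => q (σ j)))
  comp_map_right : ∀ {t : ℕ} (i i' : Fin t → ℕ) (τ : ∀ j, Fin (i j) ≃ Fin (i' j)) (p : obj t)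
    (q : ∀ j, obj (i j)),
    comp i' p (fun j => map (τ j) (q j)) = map (sumEquiv τ) (comp i p q)

/-- A set operad is basic-set if all the maps `p ↦ p ∘ (ν_1, …, ν_t)` are injective. -/
def SetOperad.IsBasic (P : SetOperad.{v}) : Prop :=
  ∀ (t : ℕ) (i : Fin t → ℕ) (ν : ∀ j, P.obj (i j)),
    Function.Injective (fun p : P.obj t => P.comp i p ν)

/-- A (symmetric) algebraic operad over `k`. -/
structure AlgOperad (k : Type u) [CommRing k] where
  /-- operations of arity `n` -/
  obj : ℕ → Type v
  [addCommGroup : ∀ n, AddCommGroup (obj n)]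
  [module : ∀ n, Module k (obj n)]
  subsingleton_zero : Subsingleton (obj 0)
  /-- relabelling of the inputs -/
  map : ∀ {m n : ℕ}, (Fin m ≃ Fin n) → obj m →ₗ[k] obj n
  map_refl : ∀ {n : ℕ} (p : obj n), map (Equiv.refl (Fin n)) p = p
  map_trans : ∀ {l m n : ℕ} (σ : Fin l ≃ Fin m) (τ : Fin m ≃ Fin n) (p : obj l),
    map (σ.trans τ) p = map τ (map σ p)
  /-- the unit -/
  one : obj 1
  /-- the composition `p ∘ (q_1, …, q_t)`, linear in every variable -/
  comp : ∀ {t : ℕ} (i : Fin t → ℕ),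
    obj t →ₗ[k] MultilinearMap k (fun j => obj (i j)) (obj (∑ j, i j))
  one_comp : ∀ {n : ℕ} (p : obj n),
    map (finCongr (sum_fin_one_const n)) (comp (fun _ : Fin 1 => n) one (fun _ => p)) = p
  comp_one : ∀ {n : ℕ} (p : obj n),
    map (finCongr (sum_fin_const_one n)) (comp (fun _ : Fin n => 1) p (fun _ => one)) = p
  comp_assoc : ∀ {t : ℕ} (i : Fin t → ℕ) (m : ∀ j, Fin (i j) → ℕ) (p : obj t)
    (q : ∀ j, obj (i j)) (r : ∀ j l, obj (m j l)),
    map (finCongr (sum_nestedArity m)) (comp (nestedArity m) (comp i p q)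
      (fun a => r (finSigmaFinEquiv.symm a).1 (finSigmaFinEquiv.symm a).2)) =
    comp (fun j => ∑ l, m j l) p (fun j => comp (m j) (q j) (r j))
  comp_map_left : ∀ {s t : ℕ} (σ : Fin s ≃ Fin t) (i : Fin t → ℕ) (p : obj s)
    (q : ∀ j, obj (i j)),
    comp i (map σ p) q = map (blockEquiv σ i) (comp (fun j => i (σ j)) p (fun j => q (σ j)))
  comp_map_right : ∀ {t : ℕ} (i i' : Fin t → ℕ) (τ : ∀ j, Fin (i j) ≃ Fin (i' j)) (p : obj t)
    (q : ∀ j, obj (i j)),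
    comp i' p (fun j => map (τ j) (q j)) = map (sumEquiv τ) (comp i p q)

attribute [instance] AlgOperad.addCommGroup AlgOperad.module

/-- Isomorphism of algebraic operads. -/
structure AlgOperad.Iso {k : Type u} [CommRing k] (P : AlgOperad.{u, v} k)
    (Q : AlgOperad.{u, w} k) where
  /-- the linear isomorphism in arity `n` -/
  equiv : ∀ n, P.obj n ≃ₗ[k] Q.obj n
  equiv_map : ∀ {m n : ℕ} (σ : Fin m ≃ Fin n) (p : P.obj m),
    equiv n (P.map σ p) = Q.map σ (equiv m p)
  equiv_one : equiv 1 P.one = Q.one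
  equiv_comp : ∀ {t : ℕ} (i : Fin t → ℕ) (p : P.obj t) (q : ∀ j, P.obj (i j)),
    equiv (∑ j, i j) (P.comp i p q) = Q.comp i (equiv t p) (fun j => equiv (i j) (q j))

/-! ### The linearization of a set operad -/

/-- Multilinear extension of a map defined on families of basis elements. -/
def multilinearExtend (k : Type u) [CommRing k] {t : ℕ} {κ : Fin t → Type v} {N : Type w}
    [AddCommGroup N] [Module k N] (g : (∀ j, κ j) → N) :
    MultilinearMap k (fun j => κ j →₀ k) N := by
  classical
  exact (MultilinearMap.fromDFinsuppEquiv (M := fun _ _ => k) κ k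
    (fun p => MultilinearMap.mkPiRing k (Fin t) (g p))).compLinearMap
    (fun j => (finsuppLequivDFinsupp k).toLinearMap)

theorem multilinearExtend_single (k : Type u) [CommRing k] {t : ℕ} {κ : Fin t → Type v}
    {N : Type w} [AddCommGroup N] [Module k N] (g : (∀ j, κ j) → N) (x : ∀ j, κ j) :
    multilinearExtend k g (fun j => Finsupp.single (x j) 1) = g x := by
  classical
  have : multilinearExtend k g (fun j => Finsupp.single (x j) 1) =
    MultilinearMap.fromDFinsuppEquiv (M := fun _ _ => k) κ k
      (fun p => MultilinearMap.mkPiRing k (Fin t) (g p))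
      (fun j => DFinsupp.single (x j) (1 : k)) := by
    simp only [multilinearExtend, MultilinearMap.compLinearMap_apply]
    congr 1
    funext j
    simp [finsuppLequivDFinsupp]
  rw [this, MultilinearMap.fromDFinsuppEquiv_single]
  simp

theorem multilinear_ext_single {k : Type u} [CommRing k] {ι : Type*} [Finite ι]
    {κ : ι → Type v} {N : Type w} [AddCommGroup N] [Module k N]
    {f g : MultilinearMap k (fun j => κ j →₀ k) N}
    (h : ∀ x : ∀ j, κ j, f (fun j => Finsupp.single (x j) 1) = g (fun j => Finsupp.single (x j) 1)) :
    f = g :=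
  Module.Basis.ext_multilinear (fun _ => Finsupp.basisSingleOne) (by simpa using h)

/-- Reindexing of the variables of a multilinear map. -/
def multilinearReindex {k : Type u} [CommRing k] {ι ι' : Type} {M : ι → Type v} {N : Type w}
    [∀ j, AddCommGroup (M j)] [∀ j, Module k (M j)] [AddCommGroup N] [Module k N]
    (e : ι' ≃ ι) (g : MultilinearMap k (fun a => M (e a)) N) : MultilinearMap k M N :=
  (MultilinearMap.domDomCongrLinearEquiv' k k M N e.symm).symm g

theorem multilinearReindex_apply {k : Type u} [CommRing k] {ι ι' : Type} {M : ι → Type v}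
    {N : Type w}
    [∀ j, AddCommGroup (M j)] [∀ j, Module k (M j)] [AddCommGroup N] [Module k N]
    (e : ι' ≃ ι) (g : MultilinearMap k (fun a => M (e a)) N) (x : ∀ j, M j) :
    multilinearReindex e g x = g (fun a => x (e a)) := rfl

/-- Evaluation of multilinear maps at a given point. -/
def multilinearEval {k : Type u} [CommRing k] {ι : Type} {M : ι → Type v} {N : Type w}
    [∀ j, AddCommGroup (M j)] [∀ j, Module k (M j)] [AddCommGroup N] [Module k N]
    (x : ∀ j, M j) : MultilinearMap k M N →ₗ[k] N where
  toFun f := f x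
  map_add' _ _ := rfl
  map_smul' _ _ := rfl

namespace SetOperad

variable (k : Type u) [CommRing k] (P : SetOperad.{v})

/-- The composition of `k[P]`: the extension of that of `P`, linear in every variable. -/
def linComp {t : ℕ} (i : Fin t → ℕ) :
    (P.obj t →₀ k) →ₗ[k] MultilinearMap k (fun j => P.obj (i j) →₀ k) (P.obj (∑ j, i j) →₀ k) :=
  Finsupp.lift _ k _ (fun p => multilinearExtend k (fun q => Finsupp.single (P.comp i p q) 1))

theorem linComp_single {t : ℕ} (i : Fin t → ℕ) (p : P.obj t) (q : ∀ j, P.obj (i j)) :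
    P.linComp k i (Finsupp.single p 1) (fun j => Finsupp.single (q j) 1) =
      Finsupp.single (P.comp i p q) 1 := by
  simp [linComp, multilinearExtend_single]

theorem mapDomain_map_single {m n : ℕ} (σ : Fin m ≃ Fin n) (p : P.obj m) :
    Finsupp.lmapDomain k k (P.map σ) (Finsupp.single p 1) = Finsupp.single (P.map σ p) 1 := by
  simp

theorem linComp_one_left {n : ℕ} (p : P.obj n →₀ k) :
    Finsupp.lmapDomain k k (P.map (finCongr (sum_fin_one_const n)))
      (P.linComp k (fun _ : Fin 1 => n) (Finsupp.single P.one 1) (fun _ => p)) = p := by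
  have key : ((Finsupp.lmapDomain k k (P.map (finCongr (sum_fin_one_const n)))).compMultilinearMap
      (P.linComp k (fun _ : Fin 1 => n) (Finsupp.single P.one 1))) =
      MultilinearMap.ofSubsingleton k _ _ (0 : Fin 1) LinearMap.id := by
    refine multilinear_ext_single fun x => ?_
    obtain ⟨y, rfl⟩ : ∃ y, x = fun _ => y := ⟨x 0, by funext j; rw [Fin.fin_one_eq_zero j]⟩
    rw [LinearMap.compMultilinearMap_apply, linComp_single, mapDomain_map_single, P.one_comp]
    rfl
  exact congrArg (fun f => f (fun _ => p)) key

theorem linComp_one_right {n : ℕ} (p : P.obj n →₀ k) :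
    Finsupp.lmapDomain k k (P.map (finCongr (sum_fin_const_one n)))
      (P.linComp k (fun _ : Fin n => 1) p (fun _ => Finsupp.single P.one 1)) = p := by
  have key : (Finsupp.lmapDomain k k (P.map (finCongr (sum_fin_const_one n)))) ∘ₗ
      (multilinearEval (k := k) (fun _ => Finsupp.single P.one (1 : k))) ∘ₗ
      (P.linComp k (fun _ : Fin n => 1)) = LinearMap.id := by
    refine Finsupp.lhom_ext' fun x => LinearMap.ext_ring ?_
    change Finsupp.lmapDomain k k (P.map (finCongr (sum_fin_const_one n)))
      (P.linComp k (fun _ : Fin n => 1) (Finsupp.single x 1) (fun _ => Finsupp.single P.one 1)) =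
      Finsupp.single x 1
    rw [linComp_single, mapDomain_map_single, P.comp_one]
  exact congrArg (fun f => f p) key

theorem linComp_map_left {s t : ℕ} (σ : Fin s ≃ Fin t) (i : Fin t → ℕ) (p : P.obj s →₀ k)
    (q : ∀ j, P.obj (i j) →₀ k) :
    P.linComp k i (Finsupp.lmapDomain k k (P.map σ) p) q =
      Finsupp.lmapDomain k k (P.map (blockEquiv σ i))
        (P.linComp k (fun j => i (σ j)) p (fun j => q (σ j))) := by
  have key : (multilinearEval (k := k) q) ∘ₗ (P.linComp k i) ∘ₗ (Finsupp.lmapDomain k k (P.map σ)) =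
      (Finsupp.lmapDomain k k (P.map (blockEquiv σ i))) ∘ₗ (multilinearEval (k := k) (fun j => q (σ j))) ∘ₗ
        (P.linComp k (fun j => i (σ j))) := by
    refine Finsupp.lhom_ext' fun x => LinearMap.ext_ring ?_
    have key2 : P.linComp k i (Finsupp.lmapDomain k k (P.map σ) (Finsupp.single x 1)) =
        multilinearReindex (M := fun j => P.obj (i j) →₀ k) σ
          ((Finsupp.lmapDomain k k (P.map (blockEquiv σ i))).compMultilinearMap
          (P.linComp k (fun j => i (σ j)) (Finsupp.single x 1))) := by
      refine multilinear_ext_single fun y => ?_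
      rw [multilinearReindex_apply, LinearMap.compMultilinearMap_apply, mapDomain_map_single,
        linComp_single, linComp_single (k := k) (i := fun j => i (σ j)) (q := fun j => y (σ j)),
        mapDomain_map_single, P.comp_map_left]
    exact congrArg (fun f => f q) key2
  exact congrArg (fun f => f p) key

theorem linComp_map_right {t : ℕ} (i i' : Fin t → ℕ) (τ : ∀ j, Fin (i j) ≃ Fin (i' j))
    (p : P.obj t →₀ k) (q : ∀ j, P.obj (i j) →₀ k) :
    P.linComp k i' p (fun j => Finsupp.lmapDomain k k (P.map (τ j)) (q j)) =
      Finsupp.lmapDomain k k (P.map (sumEquiv τ)) (P.linComp k i p q) := by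
  have key : (multilinearEval (k := k) (fun j => Finsupp.lmapDomain k k (P.map (τ j)) (q j))) ∘ₗ
      (P.linComp k i') =
      (Finsupp.lmapDomain k k (P.map (sumEquiv τ))) ∘ₗ (multilinearEval (k := k) q) ∘ₗ (P.linComp k i) := by
    refine Finsupp.lhom_ext' fun x => LinearMap.ext_ring ?_
    have key2 : (P.linComp k i' (Finsupp.single x 1)).compLinearMap
        (fun j => Finsupp.lmapDomain k k (P.map (τ j))) =
        (Finsupp.lmapDomain k k (P.map (sumEquiv τ))).compMultilinearMap
          (P.linComp k i (Finsupp.single x 1)) := by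
      refine multilinear_ext_single fun y => ?_
      rw [MultilinearMap.compLinearMap_apply, LinearMap.compMultilinearMap_apply, linComp_single]
      simp only [mapDomain_map_single]
      rw [linComp_single, P.comp_map_right]
    exact congrArg (fun f => f q) key2
  exact congrArg (fun f => f p) key

theorem linComp_assoc {t : ℕ} (i : Fin t → ℕ) (m : ∀ j, Fin (i j) → ℕ) (p : P.obj t →₀ k)
    (q : ∀ j, P.obj (i j) →₀ k) (r : ∀ j l, P.obj (m j l) →₀ k) :
    Finsupp.lmapDomain k k (P.map (finCongr (sum_nestedArity m)))
      (P.linComp k (nestedArity m) (P.linComp k i p q)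
        (fun a => r (finSigmaFinEquiv.symm a).1 (finSigmaFinEquiv.symm a).2)) =
      P.linComp k (fun j => ∑ l, m j l) p (fun j => P.linComp k (m j) (q j) (r j)) := by
  let R : ∀ a, P.obj (nestedArity m a) →₀ k :=
    fun a => r (finSigmaFinEquiv.symm a).1 (finSigmaFinEquiv.symm a).2
  let Φ := Finsupp.lmapDomain k k (P.map (finCongr (sum_nestedArity m)))
  have key : Φ ∘ₗ (multilinearEval (k := k) R) ∘ₗ (P.linComp k (nestedArity m)) ∘ₗ (multilinearEval (k := k) q) ∘ₗ
      (P.linComp k i) = (multilinearEval (k := k) (fun j => P.linComp k (m j) (q j) (r j))) ∘ₗ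
      (P.linComp k (fun j => ∑ l, m j l)) := by
    refine Finsupp.lhom_ext' fun x => LinearMap.ext_ring ?_
    have key2 : (Φ ∘ₗ (multilinearEval (k := k) R) ∘ₗ (P.linComp k (nestedArity m))).compMultilinearMap
          (P.linComp k i (Finsupp.single x 1)) =
        (P.linComp k (fun j => ∑ l, m j l) (Finsupp.single x 1)).compLinearMap
          (fun j => (multilinearEval (k := k) (r j)) ∘ₗ (P.linComp k (m j))) := by
      refine multilinear_ext_single fun y => ?_
      have key3 : multilinearReindex
            (M := fun s : (Σ j : Fin t, Fin (i j)) => P.obj (m s.1 s.2) →₀ k)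
            finSigmaFinEquiv.symm
            (Φ.compMultilinearMap
              (P.linComp k (nestedArity m) (Finsupp.single (P.comp i x y) 1))) =
          (P.linComp k (fun j => ∑ l, m j l) (Finsupp.single x 1)).compMultilinearMap
            (fun j => P.linComp k (m j) (Finsupp.single (y j) 1)) := by
        refine multilinear_ext_single fun z => ?_
        rw [multilinearReindex_apply, LinearMap.compMultilinearMap_apply,
          linComp_single (k := k) (i := nestedArity m) (q := fun a => z (finSigmaFinEquiv.symm a)),
          mapDomain_map_single]
        rw [MultilinearMap.compMultilinearMap_apply]
        refine Eq.trans ?_ (congrArg (P.linComp k (fun j => ∑ l, m j l) (Finsupp.single x 1))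
          (funext fun j => (linComp_single k P (m j) (y j) (fun l => z ⟨j, l⟩)).symm))
        rw [linComp_single, ← P.comp_assoc i m x y (fun j l => z ⟨j, l⟩)]
      have h3 := congrArg (fun f => f (fun s => r s.1 s.2)) key3
      rw [LinearMap.compMultilinearMap_apply, linComp_single]
      exact h3
    exact congrArg (fun f => f q) key2
  exact congrArg (fun f => f p) key

/-- The algebraic operad `k[P]` of a set operad `P`: in arity `n` the free module on `P n`. -/
def linearize : AlgOperad.{u, max v u} k where
  obj n := P.obj n →₀ k
  subsingleton_zero := by
    have := P.isEmpty_zero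
    infer_instance
  map σ := Finsupp.lmapDomain k k (P.map σ)
  map_refl {n} p := by
    have : P.map (Equiv.refl (Fin n)) = id := funext fun p => P.map_refl p
    simp [this]
  map_trans σ τ p := by
    have : P.map (σ.trans τ) = P.map τ ∘ P.map σ := funext (P.map_trans σ τ)
    simp [this, Finsupp.mapDomain_comp]
  one := Finsupp.single P.one 1
  comp i := P.linComp k i
  one_comp p := P.linComp_one_left k p
  comp_one p := P.linComp_one_right k p
  comp_assoc i m p q r := P.linComp_assoc k i m p q r
  comp_map_left σ i p q := P.linComp_map_left k σ i p q
  comp_map_right i i' τ p q := P.linComp_map_right k i i' τ p q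

/-- The basis element of `k[P]` given by an operation `x` of `P`. -/
def basisElt {n : ℕ} (x : P.obj n) : (P.linearize k).obj n := (Finsupp.single x 1 : P.obj n →₀ k)

end SetOperad

/-! ### Ideals and quotients of algebraic operads -/

/-- If a multilinear map vanishes as soon as one variable lies in the submodule `I j`, then its value
only depends on the variables modulo the `I j`. -/
theorem multilinear_sub_mem {k : Type u} [CommRing k] {t : ℕ} {M : Fin t → Type v} {N : Type w}
    [∀ j, AddCommGroup (M j)] [∀ j, Module k (M j)] [AddCommGroup N] [Module k N]
    (I : ∀ j, Submodule k (M j)) (f : MultilinearMap k M N)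
    (hf : ∀ q j, q j ∈ I j → f q = 0) (q q' : ∀ j, M j) (h : ∀ j, q j - q' j ∈ I j) :
    f q = f q' := by
  have h1 := f.map_sub_map_piecewise q q' Finset.univ
  rw [Finset.piecewise_univ] at h1
  rw [← sub_eq_zero, h1]
  refine Finset.sum_eq_zero fun j _ => hf _ j ?_
  simpa using h j

/-- The multilinear map induced on the quotients. -/
def multilinearQuotient {k : Type u} [CommRing k] {t : ℕ} {M : Fin t → Type v} {N : Type w}
    [∀ j, AddCommGroup (M j)] [∀ j, Module k (M j)] [AddCommGroup N] [Module k N]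
    (I : ∀ j, Submodule k (M j)) (f : MultilinearMap k M N)
    (hf : ∀ q j, q j ∈ I j → f q = 0) : MultilinearMap k (fun j => M j ⧸ I j) N where
  toFun q := f (fun j => (q j).out)
  map_update_add' q j x y := by
    have key : ∀ z : M j ⧸ I j, f (fun l => (Function.update q j z l).out) =
        f (Function.update (fun l => (q l).out) j z.out) := by
      intro z
      congr 1
      funext l
      rcases eq_or_ne l j with rfl | hl
      · simp
      · simp [hl]
    rw [key, key, key, ← f.map_update_add]
    refine multilinear_sub_mem I f hf _ _ fun l => ?_
    rcases eq_or_ne l j with rfl | hl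
    · rw [Function.update_self, Function.update_self, ← Submodule.Quotient.eq]
      simp only [Submodule.Quotient.mk_add, Submodule.Quotient.mk_out]
    · simp [hl]
  map_update_smul' q j c x := by
    have key : ∀ z : M j ⧸ I j, f (fun l => (Function.update q j z l).out) =
        f (Function.update (fun l => (q l).out) j z.out) := by
      intro z
      congr 1
      funext l
      rcases eq_or_ne l j with rfl | hl
      · simp
      · simp [hl]
    rw [key, key, ← f.map_update_smul]
    refine multilinear_sub_mem I f hf _ _ fun l => ?_
    rcases eq_or_ne l j with rfl | hl
    · rw [Function.update_self, Function.update_self, ← Submodule.Quotient.eq]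
      simp
    · simp [hl]

theorem multilinearQuotient_mk {k : Type u} [CommRing k] {t : ℕ} {M : Fin t → Type v} {N : Type w}
    [∀ j, AddCommGroup (M j)] [∀ j, Module k (M j)] [AddCommGroup N] [Module k N]
    (I : ∀ j, Submodule k (M j)) (f : MultilinearMap k M N)
    (hf : ∀ q j, q j ∈ I j → f q = 0) (q : ∀ j, M j) :
    multilinearQuotient I f hf (fun j => Submodule.Quotient.mk (q j)) = f q := by
  refine multilinear_sub_mem I f hf _ _ fun l => ?_
  rw [← Submodule.Quotient.eq]
  simp

namespace AlgOperad

variable {k : Type u} [CommRing k]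

/-- An operadic ideal: submodules stable under relabelling, such that a composite lies in the ideal
as soon as one of its factors does. -/
structure Ideal (P : AlgOperad.{u, v} k) where
  /-- the ideal in arity `n` -/
  carrier : ∀ n, Submodule k (P.obj n)
  map_mem : ∀ {m n : ℕ} (σ : Fin m ≃ Fin n) {p : P.obj m}, p ∈ carrier m → P.map σ p ∈ carrier n
  comp_mem_left : ∀ {t : ℕ} (i : Fin t → ℕ) {p : P.obj t} (q : ∀ j, P.obj (i j)),
    p ∈ carrier t → P.comp i p q ∈ carrier (∑ j, i j)
  comp_mem_right : ∀ {t : ℕ} (i : Fin t → ℕ) (p : P.obj t) (q : ∀ j, P.obj (i j)) (j : Fin t),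
    q j ∈ carrier (i j) → P.comp i p q ∈ carrier (∑ j, i j)

/-- The operadic ideal generated by a collection of relations, i.e. the smallest one
containing them. -/
def idealSpan (P : AlgOperad.{u, v} k) (R : ∀ n, Set (P.obj n)) : P.Ideal where
  carrier n := ⨅ (J : P.Ideal) (_ : ∀ m, R m ⊆ J.carrier m), J.carrier n
  map_mem σ p hp := by
    simp only [Submodule.mem_iInf] at hp ⊢
    exact fun J hJ => J.map_mem σ (hp J hJ)
  comp_mem_left i p q hp := by
    simp only [Submodule.mem_iInf] at hp ⊢
    exact fun J hJ => J.comp_mem_left i q (hp J hJ)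
  comp_mem_right i p q j hq := by
    simp only [Submodule.mem_iInf] at hq ⊢
    exact fun J hJ => J.comp_mem_right i p q j (hq J hJ)

variable (P : AlgOperad.{u, v} k) (I : P.Ideal)

/-- The composition induced on the quotient by an ideal. -/
def quotientComp {t : ℕ} (i : Fin t → ℕ) :
    (P.obj t ⧸ I.carrier t) →ₗ[k] MultilinearMap k (fun j => P.obj (i j) ⧸ I.carrier (i j))
      (P.obj (∑ j, i j) ⧸ I.carrier (∑ j, i j)) :=
  (I.carrier t).liftQ
    { toFun := fun p => multilinearQuotient (fun j => I.carrier (i j))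
        ((I.carrier (∑ j, i j)).mkQ.compMultilinearMap (P.comp i p))
        (fun q j hq => (Submodule.Quotient.mk_eq_zero _).2 (I.comp_mem_right i p q j hq))
      map_add' := fun p p' => by
        ext q
        simp [multilinearQuotient]
      map_smul' := fun c p => by
        ext q
        simp [multilinearQuotient] }
    (fun p hp => by
      ext q
      exact (Submodule.Quotient.mk_eq_zero _).2 (I.comp_mem_left i _ hp))

theorem quotientComp_mk {t : ℕ} (i : Fin t → ℕ) (p : P.obj t) (q : ∀ j, P.obj (i j)) :
    P.quotientComp I i (Submodule.Quotient.mk p) (fun j => Submodule.Quotient.mk (q j)) =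
      Submodule.Quotient.mk (P.comp i p q) :=
  multilinearQuotient_mk (fun j => I.carrier (i j))
    ((I.carrier (∑ j, i j)).mkQ.compMultilinearMap (P.comp i p))
    (fun q j hq => (Submodule.Quotient.mk_eq_zero _).2 (I.comp_mem_right i p q j hq)) q

/-- Relabelling of the inputs in the quotient. -/
def quotientMap {m n : ℕ} (σ : Fin m ≃ Fin n) :
    (P.obj m ⧸ I.carrier m) →ₗ[k] (P.obj n ⧸ I.carrier n) :=
  (I.carrier m).mapQ (I.carrier n) (P.map σ) (fun _ hp => I.map_mem σ hp)

theorem quotientMap_mk {m n : ℕ} (σ : Fin m ≃ Fin n) (p : P.obj m) :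
    P.quotientMap I σ (Submodule.Quotient.mk p) = Submodule.Quotient.mk (P.map σ p) := rfl

/-- The quotient of an operad by an operadic ideal. -/
def quotient : AlgOperad.{u, v} k where
  obj n := P.obj n ⧸ I.carrier n
  subsingleton_zero := by
    have := P.subsingleton_zero
    exact (Submodule.Quotient.mk_surjective (I.carrier 0)).subsingleton
  map σ := P.quotientMap I σ
  map_refl p := by
    obtain ⟨p, rfl⟩ := Submodule.Quotient.mk_surjective _ p
    rw [quotientMap_mk, P.map_refl]
  map_trans σ τ p := by
    obtain ⟨p, rfl⟩ := Submodule.Quotient.mk_surjective _ p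
    simp only [quotientMap_mk, P.map_trans]
  one := Submodule.Quotient.mk P.one
  comp i := P.quotientComp I i
  one_comp p := by
    obtain ⟨p, rfl⟩ := Submodule.Quotient.mk_surjective _ p
    rw [quotientComp_mk, quotientMap_mk, P.one_comp]
  comp_one p := by
    obtain ⟨p, rfl⟩ := Submodule.Quotient.mk_surjective _ p
    rw [quotientComp_mk, quotientMap_mk, P.comp_one]
  comp_assoc i m p q r := by
    obtain ⟨p, rfl⟩ := Submodule.Quotient.mk_surjective _ p
    choose q' hq using fun j => Submodule.Quotient.mk_surjective _ (q j)
    choose r' hr using fun j l => Submodule.Quotient.mk_surjective _ (r j l)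
    obtain rfl : (fun j => Submodule.Quotient.mk (q' j)) = q := funext hq
    obtain rfl : (fun j l => Submodule.Quotient.mk (r' j l)) = r :=
      funext fun j => funext fun l => hr j l
    simp only [quotientComp_mk]
    rw [quotientMap_mk, P.comp_assoc]
  comp_map_left σ i p q := by
    obtain ⟨p, rfl⟩ := Submodule.Quotient.mk_surjective _ p
    choose q' hq using fun j => Submodule.Quotient.mk_surjective _ (q j)
    obtain rfl : (fun j => Submodule.Quotient.mk (q' j)) = q := funext hq
    rw [quotientMap_mk, quotientComp_mk, quotientComp_mk P I (fun j => i (σ j)) p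
      (fun j => q' (σ j)), quotientMap_mk, P.comp_map_left]
  comp_map_right i i' τ p q := by
    obtain ⟨p, rfl⟩ := Submodule.Quotient.mk_surjective _ p
    choose q' hq using fun j => Submodule.Quotient.mk_surjective _ (q j)
    obtain rfl : (fun j => Submodule.Quotient.mk (q' j)) = q := funext hq
    simp only [quotientMap_mk, quotientComp_mk]
    rw [P.comp_map_right]

end AlgOperad

/-! ### The free operad on binary operations -/

/-- Planar binary trees with vertices labelled by `G` and leaves labelled by `α`. -/
inductive BinTree (G : Type v) (α : Type w) : Type (max v w)
  | leaf : α → BinTree G α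
  | node : G → BinTree G α → BinTree G α → BinTree G α

namespace BinTree

variable {G : Type v}

/-- Grafting: the leaf labelled `a` is replaced by the tree `f a`. -/
def bind {α β : Type w} (f : α → BinTree G β) : BinTree G α → BinTree G β
  | leaf a => f a
  | node g x y => node g (bind f x) (bind f y)

/-- Relabelling of the leaves. -/
def map {α β : Type w} (f : α → β) : BinTree G α → BinTree G β := bind (fun a => leaf (f a))

/-- The labels of the leaves, from left to right. -/
def leaves {α : Type w} : BinTree G α → List α
  | leaf a => [a]
  | node _ x y => leaves x ++ leaves y

theorem bind_bind {α β γ : Type w} (f : α → BinTree G β) (g : β → BinTree G γ) (x : BinTree G α) :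
    bind g (bind f x) = bind (fun a => bind g (f a)) x := by
  induction x with
  | leaf a => rfl
  | node o x y hx hy => simp [bind, hx, hy]

theorem bind_leaf {α : Type w} (x : BinTree G α) : bind leaf x = x := by
  induction x with
  | leaf a => rfl
  | node o x y hx hy => simp [bind, hx, hy]

theorem leaves_bind {α β : Type w} (f : α → BinTree G β) (x : BinTree G α) :
    (bind f x).leaves = x.leaves.flatMap (fun a => (f a).leaves) := by
  induction x with
  | leaf a => simp [bind, leaves]
  | node o x y hx hy => simp [bind, leaves, hx, hy]

theorem leaves_map {α β : Type w} (f : α → β) (x : BinTree G α) :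
    (map f x).leaves = x.leaves.map f := by
  rw [map, leaves_bind]
  induction x.leaves with
  | nil => rfl
  | cons a l ih => rw [List.flatMap_cons, ih]; rfl

theorem leaves_ne_nil {α : Type w} (x : BinTree G α) : x.leaves ≠ [] := by
  induction x with
  | leaf a => simp [leaves]
  | node o x y hx hy => simp [leaves, hx]

/-- Every label is used exactly once. -/
def IsMultilinear {α : Type w} (x : BinTree G α) : Prop := x.leaves.Nodup ∧ ∀ a, a ∈ x.leaves

theorem IsMultilinear.map_equiv {α β : Type w} {x : BinTree G α} (hx : x.IsMultilinear)
    (σ : α ≃ β) : (map σ x).IsMultilinear := by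
  refine ⟨?_, fun b => ?_⟩
  · rw [leaves_map]
    exact hx.1.map σ.injective
  · rw [leaves_map, List.mem_map]
    exact ⟨σ.symm b, hx.2 _, by simp⟩

/-- Grafting of the trees `y j` at the leaves of `x`, the leaves of the result being numbered in
blocks. -/
def graft {t : ℕ} {i : Fin t → ℕ} (x : BinTree G (Fin t)) (y : ∀ j, BinTree G (Fin (i j))) :
    BinTree G (Fin (∑ j, i j)) :=
  bind (fun j => map (fun a => finSigmaFinEquiv ⟨j, a⟩) (y j)) x

theorem IsMultilinear.graft {t : ℕ} {i : Fin t → ℕ} {x : BinTree G (Fin t)}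
    {y : ∀ j, BinTree G (Fin (i j))} (hx : x.IsMultilinear) (hy : ∀ j, (y j).IsMultilinear) :
    (BinTree.graft x y).IsMultilinear := by
  refine ⟨?_, fun b => ?_⟩
  · rw [BinTree.graft, leaves_bind, List.nodup_flatMap]
    refine ⟨fun j _ => ?_, ?_⟩
    · rw [leaves_map]
      refine (hy j).1.map fun a a' h => ?_
      simpa using h
    · refine hx.1.imp fun {j j'} hne => ?_
      simp only [Function.onFun, leaves_map, List.disjoint_left, List.mem_map]
      rintro _ ⟨a, _, rfl⟩ ⟨a', _, h⟩
      have := congrArg Sigma.fst (finSigmaFinEquiv.injective h)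
      exact hne this.symm
  · obtain ⟨⟨j, a⟩, rfl⟩ := finSigmaFinEquiv.surjective b
    rw [BinTree.graft, leaves_bind, List.mem_flatMap]
    refine ⟨j, hx.2 j, ?_⟩
    rw [leaves_map, List.mem_map]
    exact ⟨a, (hy j).2 a, rfl⟩

end BinTree

/-- The set operad of binary trees with vertices labelled by `G`: the operations of arity `n` are
the trees whose leaves are labelled bijectively by `Fin n`, and composition is grafting. It is the
free set operad on the binary operations `G`, without any symmetry. -/
def treeOperad (G : Type v) : SetOperad.{v} where
  obj n := {x : BinTree G (Fin n) // x.IsMultilinear}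
  isEmpty_zero := by
    refine ⟨fun x => x.1.leaves_ne_nil (List.eq_nil_iff_forall_not_mem.2 fun a => a.elim0)⟩
  map σ x := ⟨BinTree.map σ x.1, x.2.map_equiv σ⟩
  map_refl x := Subtype.ext (BinTree.bind_leaf x.1)
  map_trans σ τ x := Subtype.ext (by simp [BinTree.map, BinTree.bind_bind, BinTree.bind])
  one := ⟨.leaf 0, by simp [BinTree.leaves], fun a => by
    rw [Fin.fin_one_eq_zero a]; simp [BinTree.leaves]⟩
  comp i x y := ⟨BinTree.graft x.1 (fun j => (y j).1), x.2.graft (fun j => (y j).2)⟩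
  one_comp x := Subtype.ext (by
    simp only [BinTree.map, BinTree.graft, BinTree.bind_bind, BinTree.bind, finCongr_one_block]
    exact BinTree.bind_leaf x.1)
  comp_one x := Subtype.ext (by
    simp only [BinTree.map, BinTree.graft, BinTree.bind_bind, BinTree.bind, finCongr_unit_blocks]
    exact BinTree.bind_leaf x.1)
  comp_assoc i m x y z := Subtype.ext (by
    simp only [BinTree.map, BinTree.graft, BinTree.bind_bind, BinTree.bind,
      finSigmaFinEquiv_assoc]
    congr 1
    funext a
    congr 1
    funext b
    have key : ∀ s : (Σ j, Fin (i j)), s = ⟨a, b⟩ →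
        BinTree.bind (fun c => BinTree.leaf
          (finSigmaFinEquiv ⟨s.1, finSigmaFinEquiv ⟨s.2, c⟩⟩ : Fin (∑ j, ∑ l, m j l)))
          (z s.1 s.2).1 =
        BinTree.bind (fun c => BinTree.leaf
          (finSigmaFinEquiv ⟨a, finSigmaFinEquiv ⟨b, c⟩⟩ : Fin (∑ j, ∑ l, m j l))) (z a b).1 := by
      rintro _ rfl
      rfl
    exact key _ (Equiv.symm_apply_apply _ _))
  comp_map_left σ i x y := Subtype.ext (by
    simp only [BinTree.map, BinTree.graft, BinTree.bind_bind, BinTree.bind, blockEquiv_apply])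
  comp_map_right i i' τ x y := Subtype.ext (by
    simp only [BinTree.map, BinTree.graft, BinTree.bind_bind, BinTree.bind, sumEquiv_apply])

/-! ### The operad of commutative trialgebras -/

/-- The two generating operations of commutative trialgebras. -/
inductive TriOp : Type
  | star : TriOp
  | bullet : TriOp

/-- `x ⋆ y` -/
def BinTree.star {α : Type} (x y : BinTree TriOp α) : BinTree TriOp α := .node .star x y

/-- `x • y` -/
def BinTree.bullet {α : Type} (x y : BinTree TriOp α) : BinTree TriOp α := .node .bullet x y

open BinTree in
/-- The defining identities of commutative trialgebras, in the variables `x, y, z`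
(which are the inputs `0, 1, 2`). -/
inductive ComTriasRel : ∀ n : ℕ, BinTree TriOp (Fin n) → BinTree TriOp (Fin n) → Prop
  /-- `(x ⋆ y) ⋆ z = x ⋆ (y ⋆ z)` -/
  | star_assoc : ComTriasRel 3 (star (star (leaf 0) (leaf 1)) (leaf 2))
      (star (leaf 0) (star (leaf 1) (leaf 2)))
  /-- `x ⋆ (y ⋆ z) = x ⋆ (z ⋆ y)` -/
  | star_perm : ComTriasRel 3 (star (leaf 0) (star (leaf 1) (leaf 2)))
      (star (leaf 0) (star (leaf 2) (leaf 1)))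
  /-- `x • y = y • x` -/
  | bullet_comm : ComTriasRel 2 (bullet (leaf 0) (leaf 1)) (bullet (leaf 1) (leaf 0))
  /-- `(x • y) • z = x • (y • z)` -/
  | bullet_assoc : ComTriasRel 3 (bullet (bullet (leaf 0) (leaf 1)) (leaf 2))
      (bullet (leaf 0) (bullet (leaf 1) (leaf 2)))
  /-- `x ⋆ (y • z) = x ⋆ (y ⋆ z)` -/
  | star_bullet : ComTriasRel 3 (star (leaf 0) (bullet (leaf 1) (leaf 2)))
      (star (leaf 0) (star (leaf 1) (leaf 2)))
  /-- `(x • y) ⋆ z = x • (y ⋆ z)` -/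
  | bullet_star : ComTriasRel 3 (star (bullet (leaf 0) (leaf 1)) (leaf 2))
      (bullet (leaf 0) (star (leaf 1) (leaf 2)))

/-- The free algebraic operad on two binary operations: linear combinations of trees. -/
def freeTriOperad (k : Type u) [CommRing k] : AlgOperad.{u, u} k := (treeOperad TriOp).linearize k

/-- The relators of the operad of commutative trialgebras. -/
def comTriasRelators (k : Type u) [CommRing k] (n : ℕ) : Set ((freeTriOperad k).obj n) :=
  {f | ∃ x y : (treeOperad TriOp).obj n, ComTriasRel n x.1 y.1 ∧
    f = (treeOperad TriOp).basisElt k x - (treeOperad TriOp).basisElt k y}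

/-- The operad of commutative trialgebras: generated by `⋆` and `•`, subject to the defining
identities of commutative trialgebras. -/
def ComTrias (k : Type u) [CommRing k] : AlgOperad.{u, u} k :=
  (freeTriOperad k).quotient ((freeTriOperad k).idealSpan (comTriasRelators k))

/-- The operation `g (x, y)` of arity `2`, as a tree. -/
def triCorolla (g : TriOp) : (treeOperad TriOp).obj 2 :=
  ⟨.node g (.leaf 0) (.leaf 1), by simp [BinTree.leaves], fun a => by
    fin_cases a <;> simp [BinTree.leaves]⟩

/-- The generating operations of `ComTrias`. -/
def comTriasGen (k : Type u) [CommRing k] (g : TriOp) : (ComTrias k).obj 2 :=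
  Submodule.Quotient.mk ((treeOperad TriOp).basisElt k (triCorolla g))

/-! ### The set operad of nonempty subsets -/

/-- The union over `j ∈ J` of the sets `K j`, shifted to the `j`-th block, i.e. by
`i 0 + ⋯ + i (j - 1)`. -/
def blockUnion {t : ℕ} {i : Fin t → ℕ} (J : Finset (Fin t)) (K : ∀ j, Finset (Fin (i j))) :
    Finset (Fin (∑ j, i j)) :=
  J.biUnion (fun j => (K j).image (fun a => finSigmaFinEquiv ⟨j, a⟩))

theorem mem_blockUnion {t : ℕ} {i : Fin t → ℕ} (J : Finset (Fin t))
    (K : ∀ j, Finset (Fin (i j))) (j : Fin t) (a : Fin (i j)) :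
    finSigmaFinEquiv ⟨j, a⟩ ∈ blockUnion J K ↔ j ∈ J ∧ a ∈ K j := by
  simp only [blockUnion, Finset.mem_biUnion, Finset.mem_image]
  constructor
  · rintro ⟨j', hj, a', ha, h⟩
    have := finSigmaFinEquiv.injective h
    cases this
    exact ⟨hj, ha⟩
  · rintro ⟨hj, ha⟩
    exact ⟨j, hj, a, ha, rfl⟩

theorem equiv_mem_map {α β : Type*} (σ : α ≃ β) (J : Finset α) (a : α) :
    σ a ∈ J.map σ.toEmbedding ↔ a ∈ J := by simp

/-- The set operad of nonempty subsets `J` of `Fin n`: permutations act on the subsets, and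
`J ∘ (K_1, …, K_t)` is the union over `j ∈ J` of the sets `K_j`, shifted to the `j`-th block. -/
def comTriasSet : SetOperad.{0} where
  obj n := {J : Finset (Fin n) // J.Nonempty}
  isEmpty_zero := ⟨fun J => J.2.elim fun a _ => a.elim0⟩
  map σ J := ⟨J.1.map σ.toEmbedding, J.2.map⟩
  map_refl J := by simp
  map_trans σ τ J := Subtype.ext (by simp [Finset.map_map])
  one := ⟨Finset.univ, Finset.univ_nonempty⟩
  comp i J K := ⟨blockUnion J.1 (fun j => (K j).1), by
    obtain ⟨j, hj⟩ := J.2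
    exact (Finset.biUnion_nonempty).2 ⟨j, hj, (K j).2.image _⟩⟩
  one_comp {n} J := Subtype.ext (by
    ext b
    have h := equiv_mem_map (finCongr (sum_fin_one_const n))
      (blockUnion Finset.univ (fun _ : Fin 1 => J.1)) (finSigmaFinEquiv ⟨(0 : Fin 1), b⟩)
    rw [finCongr_one_block, mem_blockUnion] at h
    simpa using h)
  comp_one {n} J := Subtype.ext (by
    ext b
    have h := equiv_mem_map (finCongr (sum_fin_const_one n))
      (blockUnion J.1 (fun _ : Fin n => (Finset.univ : Finset (Fin 1))))
      (finSigmaFinEquiv ⟨b, (0 : Fin 1)⟩)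
    rw [finCongr_unit_blocks, mem_blockUnion] at h
    simpa using h)
  comp_assoc i m J K L := Subtype.ext (by
    ext b
    obtain ⟨b, rfl⟩ := (finCongr (sum_nestedArity m)).surjective b
    obtain ⟨⟨a, x⟩, rfl⟩ := finSigmaFinEquiv.surjective b
    dsimp only
    rw [equiv_mem_map, mem_blockUnion, finSigmaFinEquiv_assoc, mem_blockUnion, mem_blockUnion]
    have h := mem_blockUnion J.1 (fun j => (K j).1) (finSigmaFinEquiv.symm a).1
      (finSigmaFinEquiv.symm a).2
    rw [Sigma.eta, Equiv.apply_symm_apply] at h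
    rw [h, and_assoc])
  comp_map_left σ i J K := Subtype.ext (by
    ext b
    obtain ⟨b, rfl⟩ := (blockEquiv σ i).surjective b
    obtain ⟨⟨j, a⟩, rfl⟩ := finSigmaFinEquiv.surjective b
    dsimp only
    rw [equiv_mem_map, blockEquiv_apply, mem_blockUnion, mem_blockUnion, equiv_mem_map])
  comp_map_right i i' τ J K := Subtype.ext (by
    ext b
    obtain ⟨b, rfl⟩ := (sumEquiv τ).surjective b
    obtain ⟨⟨j, a⟩, rfl⟩ := finSigmaFinEquiv.surjective b
    dsimp only
    rw [equiv_mem_map, sumEquiv_apply, mem_blockUnion, mem_blockUnion, equiv_mem_map])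

/-- The basis element `e_J` of the free module on the nonempty subsets of `Fin n`. -/
def subsetElt (k : Type u) [CommRing k] {n : ℕ} (J : Finset (Fin n)) (hJ : J.Nonempty) :
    (comTriasSet.linearize k).obj n :=
  comTriasSet.basisElt k (⟨J, hJ⟩ : {J : Finset (Fin n) // J.Nonempty})

end

/-!
The operad `ComTrias` is presented by trees modulo relations, and the claim is that a tree with
leaves labelled by `Fin n` is determined, modulo these relations, by its support: the set of leaves
reached from the root without entering the right argument of a `⋆`.

Taking supports is a morphism `suppHom` from the set operad of trees to `comTriasSet`, and the two
sides of each defining identity have the same support. Hence its linearization kills the operadic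
ideal of relations and induces maps `ComTrias n → k[J ⊆ Fin n nonempty]` (`idealSpan_le_ker`,
`comTriasToSubsets`) which respect all the structure. Every nonempty subset is the support of some
tree (`suppHom_app_surjective`), so it remains to see that trees with the same support give the same
operation (`comTriasMk_eq_of_suppHom_eq`); then choosing a tree for every subset gives the inverse.

This last point is a computation in an arbitrary set with two operations satisfying the identities
of commutative trialgebras (`ComTrialgebra`). There, the right actions `x ↦ x ⋆ y` commute with each
other, acting by the value of a tree is the same as acting by its leaves one after the other
(`BinTree.starMul_eval`), and the actions slide out of `•`-products
(`ComTrialgebra.foldl_starMul_mul`). So every value takes the form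
`(a₁ • ⋯ • aᵣ) ⋆ b₁ ⋆ ⋯ ⋆ bₛ`, where the `a`'s are the leaves in the support, the `b`'s are the
other leaves, and the order is irrelevant in both groups
(`BinTree.exists_eval_eq_foldl`).

To apply this to `ComTrias`, one needs a trialgebra whose equalities hold in the operad. Subtrees of
a multilinear tree use only part of the labels, so the relevant congruence `BinTree.Identified`
lives on trees with arbitrary labels: two trees without repeated labels are identified if they are
relabellings of multilinear trees that agree in `ComTrias`. Since operadic composition is
grafting, this is compatible with the two operations and contains the defining identities, and the
quotient `BinTree.Identified.Class` is the required trialgebra.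
-/

/-! ### Morphisms of set operads and their linearization -/

/-- A morphism of set operads. -/
structure SetOperad.Hom (P : SetOperad.{v}) (Q : SetOperad.{w}) where
  /-- the map in arity `n` -/
  app : ∀ n, P.obj n → Q.obj n
  app_map : ∀ {m n : ℕ} (σ : Fin m ≃ Fin n) (p : P.obj m), app n (P.map σ p) = Q.map σ (app m p)
  app_one : app 1 P.one = Q.one
  app_comp : ∀ {t : ℕ} (i : Fin t → ℕ) (p : P.obj t) (q : ∀ j, P.obj (i j)),
    app (∑ j, i j) (P.comp i p q) = Q.comp i (app t p) (fun j => app (i j) (q j))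

namespace SetOperad.Hom

variable (k : Type u) [CommRing k] {P : SetOperad.{v}} {Q : SetOperad.{w}} (F : P.Hom Q)

/-- The linear map `k[P n] → k[Q n]` induced by a morphism of set operads. -/
noncomputable def lin (n : ℕ) : (P.linearize k).obj n →ₗ[k] (Q.linearize k).obj n :=
  Finsupp.lmapDomain k k (F.app n)

theorem lin_basisElt {n : ℕ} (p : P.obj n) :
    F.lin k n (P.basisElt k p) = Q.basisElt k (F.app n p) :=
  Finsupp.mapDomain_single

theorem lin_map {m n : ℕ} (σ : Fin m ≃ Fin n) (p : (P.linearize k).obj m) :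
    F.lin k n ((P.linearize k).map σ p) = (Q.linearize k).map σ (F.lin k m p) := by
  have h : F.app n ∘ P.map σ = Q.map σ ∘ F.app m := funext (F.app_map σ)
  exact (Finsupp.mapDomain_comp (v := p)).symm.trans
    ((congrArg (fun f => Finsupp.mapDomain f p) h).trans Finsupp.mapDomain_comp)

theorem lin_comp {t : ℕ} (i : Fin t → ℕ) (p : (P.linearize k).obj t)
    (q : ∀ j, (P.linearize k).obj (i j)) :
    F.lin k _ ((P.linearize k).comp i p q) =
      (Q.linearize k).comp i (F.lin k t p) (fun j => F.lin k (i j) (q j)) := by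
  change Finsupp.lmapDomain k k (F.app _) (P.linComp k i p q) =
    Q.linComp k i (Finsupp.lmapDomain k k (F.app t) p)
      (fun j => Finsupp.lmapDomain k k (F.app (i j)) (q j))
  have key : (Finsupp.lmapDomain k k (F.app _)) ∘ₗ (multilinearEval (k := k) q) ∘ₗ
      (P.linComp k i) =
      (multilinearEval (k := k) (fun j => Finsupp.lmapDomain k k (F.app (i j)) (q j))) ∘ₗ
        (Q.linComp k i) ∘ₗ (Finsupp.lmapDomain k k (F.app t)) := by
    refine Finsupp.lhom_ext' fun x => LinearMap.ext_ring ?_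
    have key2 : (Finsupp.lmapDomain k k (F.app _)).compMultilinearMap
          (P.linComp k i (Finsupp.single x 1)) =
        (Q.linComp k i (Finsupp.single (F.app t x) 1)).compLinearMap
          (fun j => Finsupp.lmapDomain k k (F.app (i j))) := by
      refine multilinear_ext_single fun y => ?_
      rw [MultilinearMap.compLinearMap_apply, LinearMap.compMultilinearMap_apply,
        SetOperad.linComp_single]
      simp only [Finsupp.lmapDomain_apply, Finsupp.mapDomain_single]
      rw [SetOperad.linComp_single, F.app_comp]
    have h := congrArg (fun f => f q) key2
    simp only [LinearMap.comp_apply, Finsupp.lsingle_apply, Finsupp.lmapDomain_apply,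
      Finsupp.mapDomain_single]
    exact h
  exact congrArg (fun f => f p) key

/-- The kernel of the linearization of a morphism of set operads, an operadic ideal. -/
noncomputable def ker : (P.linearize k).Ideal where
  carrier n := LinearMap.ker (F.lin k n)
  map_mem σ p hp := by
    rw [LinearMap.mem_ker] at hp ⊢
    rw [lin_map, hp, map_zero]
  comp_mem_left i p q hp := by
    rw [LinearMap.mem_ker] at hp ⊢
    rw [lin_comp, hp, map_zero, zero_apply]
  comp_mem_right i p q j hq := by
    rw [LinearMap.mem_ker] at hq ⊢
    rw [lin_comp]
    exact MultilinearMap.map_coord_zero _ j hq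

end SetOperad.Hom

theorem SetOperad.comp_basisElt (k : Type u) [CommRing k] (P : SetOperad.{v}) {t : ℕ}
    (i : Fin t → ℕ) (p : P.obj t) (q : ∀ j, P.obj (i j)) :
    (P.linearize k).comp i (P.basisElt k p) (fun j => P.basisElt k (q j)) =
      P.basisElt k (P.comp i p q) :=
  P.linComp_single k i p q

theorem SetOperad.map_basisElt (k : Type u) [CommRing k] (P : SetOperad.{v}) {m n : ℕ}
    (σ : Fin m ≃ Fin n) (p : P.obj m) :
    (P.linearize k).map σ (P.basisElt k p) = P.basisElt k (P.map σ p) :=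
  P.mapDomain_map_single k σ p

/-! ### Evaluation of trees in commutative trialgebras -/

/-- A set with two operations satisfying the identities of commutative trialgebras. The operation
`•` is the multiplication of the commutative semigroup, written `*`. -/
class ComTrialgebra (T : Type u) extends CommSemigroup T where
  /-- the operation `⋆` -/
  starMul : T → T → T
  starMul_assoc : ∀ x y z, starMul (starMul x y) z = starMul x (starMul y z)
  starMul_perm : ∀ x y z, starMul x (starMul y z) = starMul x (starMul z y)
  starMul_mul : ∀ x y z, starMul x (y * z) = starMul x (starMul y z)
  mul_starMul : ∀ x y z, starMul (x * y) z = x * starMul y z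

namespace ComTrialgebra

variable {T : Type u} [ComTrialgebra T]

/-- The right actions `x ↦ x ⋆ y` commute with each other. -/
instance : RightCommutative (starMul : T → T → T) where
  right_comm x y z := by rw [starMul_assoc, starMul_perm, ← starMul_assoc]

theorem foldl_starMul_mul (s : Multiset T) (x y : T) :
    s.foldl starMul (x * y) = x * s.foldl starMul y := by
  induction s using Multiset.induction_on generalizing y with
  | empty => rfl
  | cons a s ih => rw [Multiset.foldl_cons, Multiset.foldl_cons, mul_starMul, ih]

end ComTrialgebra

namespace BinTree

/-- The value of a tree in a commutative trialgebra, the leaf labelled `a` being replaced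
by `f a`. -/
def eval {T : Type u} [ComTrialgebra T] {α : Type w} (f : α → T) : BinTree TriOp α → T
  | leaf a => f a
  | node .star x y => ComTrialgebra.starMul (eval f x) (eval f y)
  | node .bullet x y => eval f x * eval f y

/-- The leaves of a tree which are reached from the root without ever entering the right argument
of `⋆`. -/
def supp {α : Type w} : BinTree TriOp α → Multiset α
  | leaf a => {a}
  | node .star x _ => supp x
  | node .bullet x y => supp x + supp y

/-- The leaves of a tree which lie in the right argument of some `⋆`. -/
def rest {α : Type w} : BinTree TriOp α → Multiset α
  | leaf _ => 0
  | node .star x y => rest x + y.leaves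
  | node .bullet x y => rest x + rest y

theorem supp_add_rest {α : Type w} (x : BinTree TriOp α) : x.supp + x.rest = x.leaves := by
  induction x with
  | leaf a => rfl
  | node g x y hx hy =>
    cases g
    · rw [supp, rest, ← add_assoc, hx]; rfl
    · rw [supp, rest, add_add_add_comm, hx, hy]; rfl

theorem supp_ne_zero {α : Type w} (x : BinTree TriOp α) : x.supp ≠ 0 := by
  induction x with
  | leaf a => simp [supp]
  | node g x y hx hy => cases g <;> simp [supp, hx]

theorem supp_bind {α β : Type w} (f : α → BinTree TriOp β) (x : BinTree TriOp α) :
    (bind f x).supp = x.supp.bind (fun a => (f a).supp) := by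
  induction x with
  | leaf a => simp [bind, supp]
  | node g x y hx hy => cases g <;> simp [bind, supp, hx, hy]

theorem supp_map {α β : Type w} (f : α → β) (x : BinTree TriOp α) :
    (map f x).supp = x.supp.map f := by
  rw [map, supp_bind]
  exact Multiset.bind_singleton _ _

section

variable {T : Type u} [ComTrialgebra T] {α : Type w} (f : α → T)

open ComTrialgebra

/-- The right argument of `⋆` only matters through the multiset of its leaves. -/
theorem starMul_eval (x : BinTree TriOp α) (b : T) :
    starMul b (eval f x) = ((x.leaves : Multiset α).map f).foldl starMul b := by
  induction x generalizing b with
  | leaf a => rfl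
  | node g x y hx hy =>
    have h : starMul b (eval f (node g x y)) = starMul b (starMul (eval f x) (eval f y)) := by
      cases g
      · rfl
      · exact starMul_mul _ _ _
    rw [h, ← starMul_assoc, hx, hy, leaves, ← Multiset.coe_add, Multiset.map_add,
      Multiset.foldl_add]

/-- The normal form of the value of a tree: the product of the values of the leaves in the support,
acted on from the right by the values of the other leaves. As the semigroup has no unit, the
product is computed in `WithOne T`. -/
theorem exists_eval_eq_foldl (x : BinTree TriOp α) :
    ∃ b : T, (b : WithOne T) = (x.supp.map (fun a => (f a : WithOne T))).prod ∧
      eval f x = (x.rest.map f).foldl starMul b := by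
  induction x with
  | leaf a => exact ⟨f a, by simp [supp], rfl⟩
  | node g x y hx hy =>
    obtain ⟨b, hb, hx⟩ := hx
    obtain ⟨c, hc, hy⟩ := hy
    cases g
    · refine ⟨b, hb, ?_⟩
      rw [eval, starMul_eval, hx, rest, Multiset.map_add, Multiset.foldl_add]
    · refine ⟨b * c, ?_, ?_⟩
      · rw [WithOne.coe_mul, hb, hc, supp, Multiset.map_add, Multiset.prod_add]
      · rw [eval, hx, hy, rest, Multiset.map_add, Multiset.foldl_add, ← foldl_starMul_mul,
          mul_comm _ c, ← foldl_starMul_mul, mul_comm c]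

theorem eval_eq_eval {x y : BinTree TriOp α} (hs : x.supp = y.supp) (hr : x.rest = y.rest) :
    eval f x = eval f y := by
  obtain ⟨b, hb, hx⟩ := exists_eval_eq_foldl f x
  obtain ⟨c, hc, hy⟩ := exists_eval_eq_foldl f y
  rw [hs, ← hc, WithOne.coe_inj] at hb
  rw [hx, hy, hr, hb]

end

theorem IsMultilinear.coe_leaves {n : ℕ} {G : Type v} {x : BinTree G (Fin n)}
    (hx : x.IsMultilinear) : (x.leaves : Multiset (Fin n)) = Finset.univ.val :=
  (Multiset.Nodup.ext (Multiset.coe_nodup.2 hx.1) Finset.univ.nodup).2 fun a => by simp [hx.2 a]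

/-- Two multilinear trees whose supports agree as sets have the same value in every commutative
trialgebra. -/
theorem eval_eq_eval_of_isMultilinear {T : Type u} [ComTrialgebra T] {n : ℕ} (f : Fin n → T)
    {x y : BinTree TriOp (Fin n)} (hx : x.IsMultilinear) (hy : y.IsMultilinear)
    (h : x.supp.toFinset = y.supp.toFinset) : eval f x = eval f y := by
  have nodup {z : BinTree TriOp (Fin n)} (hz : z.IsMultilinear) : z.supp.Nodup :=
    Multiset.nodup_of_le (Multiset.le_add_right z.supp z.rest)
      (by rw [supp_add_rest]; exact Multiset.coe_nodup.2 hz.1)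
  have hs : x.supp = y.supp := by
    rw [← Multiset.dedup_eq_self.2 (nodup hx), ← Multiset.dedup_eq_self.2 (nodup hy)]
    exact congrArg Finset.val h
  refine eval_eq_eval f hs (add_left_cancel (a := x.supp) ?_)
  rw [supp_add_rest, hs, supp_add_rest, hx.coe_leaves, hy.coe_leaves]

end BinTree

/-! ### The support morphism -/

/-- The morphism of set operads which sends a tree to the set of its leaves in the support. -/
def suppHom : (treeOperad TriOp).Hom comTriasSet where
  app _ x := ⟨x.1.supp.toFinset, by
    rw [Multiset.toFinset_nonempty]; exact x.1.supp_ne_zero⟩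
  app_map σ x := Subtype.ext (by
    ext b
    simp only [treeOperad, comTriasSet, BinTree.supp_map, Multiset.mem_toFinset, Multiset.mem_map,
      Finset.mem_map, Equiv.coe_toEmbedding])
  app_one := rfl
  app_comp i x y := Subtype.ext (by
    ext b
    simp [treeOperad, comTriasSet, BinTree.graft, BinTree.supp_bind, BinTree.supp_map, blockUnion])

theorem suppHom_app_surjective (n : ℕ) : Function.Surjective (suppHom.app n) := by
  have leaves_foldl (g : TriOp) (l : List (Fin n)) (x : BinTree TriOp (Fin n)) :
      (l.foldl (fun z a => .node g z (.leaf a)) x).leaves = x.leaves ++ l := by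
    induction l generalizing x with
    | nil => simp
    | cons a l ih => simp [ih, BinTree.leaves]
  have supp_bullet (l : List (Fin n)) (x : BinTree TriOp (Fin n)) :
      (l.foldl (fun z a => .node .bullet z (.leaf a)) x).supp = x.supp + l := by
    induction l generalizing x with
    | nil => simp
    | cons a l ih =>
      rw [List.foldl_cons, ih, BinTree.supp, add_assoc]
      rfl
  have supp_star (l : List (Fin n)) (x : BinTree TriOp (Fin n)) :
      (l.foldl (fun z a => .node .star z (.leaf a)) x).supp = x.supp := by
    induction l generalizing x with
    | nil => rfl
    | cons a l ih => rw [List.foldl_cons, ih, BinTree.supp]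
  rintro ⟨J, hJ⟩
  obtain ⟨a, l, hl⟩ := List.exists_cons_of_ne_nil (mt Finset.toList_eq_nil.1 hJ.ne_empty)
  -- the tree `(a • l₁ • l₂ • ⋯) ⋆ l'₁ ⋆ l'₂ ⋆ ⋯`, the `l'` being the elements outside `J`
  let x : BinTree TriOp (Fin n) := Jᶜ.toList.foldl (fun z a => .node .star z (.leaf a))
    (l.foldl (fun z a => .node .bullet z (.leaf a)) (.leaf a))
  have hx : x.leaves = J.toList ++ Jᶜ.toList := by
    simp only [x, leaves_foldl, hl]
    rfl
  refine ⟨⟨x, ?_, ?_⟩, Subtype.ext ?_⟩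
  · rw [hx, List.nodup_append']
    refine ⟨J.nodup_toList, Jᶜ.nodup_toList, fun b => ?_⟩
    simp
  · intro b
    rw [hx]
    simp [em]
  · have hs : x.supp = (J.toList : Multiset (Fin n)) := by
      simp only [x, supp_star, supp_bullet, hl]
      rfl
    ext b
    change b ∈ x.supp.toFinset ↔ b ∈ J
    simp [hs]

/-! ### Trees identified by the operad of commutative trialgebras -/

namespace BinTree

theorem map_map {α β γ : Type w} {G : Type v} (f : α → β) (g : β → γ)
    (x : BinTree G α) : map g (map f x) = map (fun a => g (f a)) x := by
  simp only [map, bind_bind, bind]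

theorem map_injective {α β : Type w} {G : Type v} {f : α → β} (hf : Function.Injective f) :
    Function.Injective (map f : BinTree G α → BinTree G β) := by
  intro x y h
  induction x generalizing y with
  | leaf a =>
    cases y with
    | leaf b => exact congrArg leaf (hf (leaf.inj h))
    | node g y₁ y₂ => cases h
  | node g x₁ x₂ h₁ h₂ =>
    cases y with
    | leaf b => cases h
    | node g' y₁ y₂ =>
      obtain ⟨hg, e₁, e₂⟩ := node.inj h
      rw [hg, h₁ e₁, h₂ e₂]

theorem exists_map_eq {α β : Type w} {G : Type v} (f : α → β) (x : BinTree G β)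
    (h : ∀ b ∈ x.leaves, b ∈ Set.range f) : ∃ y : BinTree G α, map f y = x := by
  induction x with
  | leaf b =>
    obtain ⟨a, rfl⟩ := h b (by simp [leaves])
    exact ⟨leaf a, rfl⟩
  | node g x₁ x₂ h₁ h₂ =>
    obtain ⟨y₁, rfl⟩ := h₁ fun b hb => h b (List.mem_append_left _ hb)
    obtain ⟨y₂, rfl⟩ := h₂ fun b hb => h b (List.mem_append_right _ hb)
    exact ⟨node g y₁ y₂, rfl⟩

/-- A tree whose leaves carry each value of the injective map `f` exactly once is the relabelling
along `f` of a multilinear tree. -/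
theorem exists_isMultilinear_map_eq {α β : Type w} {G : Type v} {f : α → β}
    (hf : Function.Injective f) {x : BinTree G β} (hx : x.leaves.Nodup)
    (h : ∀ b, b ∈ x.leaves ↔ b ∈ Set.range f) :
    ∃ y : BinTree G α, y.IsMultilinear ∧ map f y = x := by
  obtain ⟨y, rfl⟩ := exists_map_eq f x fun b hb => (h b).1 hb
  rw [leaves_map] at hx h
  refine ⟨y, ⟨List.Nodup.of_map f hx, fun a => ?_⟩, rfl⟩
  obtain ⟨a', ha', e⟩ := List.mem_map.1 ((h (f a)).2 ⟨a, rfl⟩)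
  exact hf e ▸ ha'

/-- Standardization of a tree without repeated labels. -/
theorem exists_treeOperad_map_eq {α : Type} {G : Type v} {x : BinTree G α}
    (hx : x.leaves.Nodup) :
    ∃ (n : ℕ) (f : Fin n → α) (y : (treeOperad G).obj n), map f y.1 = x := by
  obtain ⟨y, hy, h⟩ := exists_isMultilinear_map_eq (f := x.leaves.get)
    (List.nodup_iff_injective_get.1 hx) hx (fun b => by simp [List.mem_iff_get])
  exact ⟨_, _, ⟨y, hy⟩, h⟩

theorem IsMultilinear.mem_leaves_map {α β : Type w} {G : Type v} {f : α → β} {x : BinTree G α}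
    (hx : x.IsMultilinear) (b : β) : b ∈ (map f x).leaves ↔ b ∈ Set.range f := by
  rw [leaves_map, List.mem_map]
  exact ⟨fun ⟨a, _, h⟩ => ⟨a, h⟩, fun ⟨a, h⟩ => ⟨a, hx.2 a, h⟩⟩

theorem IsMultilinear.injective_of_nodup {α β : Type w} {G : Type v} {f : α → β}
    {x : BinTree G α} (hx : x.IsMultilinear) (h : (map f x).leaves.Nodup) :
    Function.Injective f := by
  rw [leaves_map] at h
  exact fun a b e => List.inj_on_of_nodup_map h (hx.2 a) (hx.2 b) e

/-- Substitution of relabelled trees is the relabelling of a grafting. -/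
theorem bind_map_eq_map_graft {α : Type} {G : Type v} {t : ℕ} {i : Fin t → ℕ}
    (p : BinTree G (Fin t)) (q : ∀ j, BinTree G (Fin (i j))) (f : ∀ j, Fin (i j) → α) :
    bind (fun j => map (f j) (q j)) p =
      map (fun b => f (finSigmaFinEquiv.symm b).1 (finSigmaFinEquiv.symm b).2) (graft p q) := by
  have h (j : Fin t) (a : Fin (i j)) :
      f (finSigmaFinEquiv.symm (finSigmaFinEquiv ⟨j, a⟩)).1
        (finSigmaFinEquiv.symm (finSigmaFinEquiv ⟨j, a⟩)).2 = f j a := by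
    rw [Equiv.symm_apply_apply]
  simp only [graft, map, bind_bind, bind, h]

end BinTree

/-- The operation of `ComTrias` given by a tree. -/
noncomputable def comTriasMk (k : Type u) [CommRing k] {n : ℕ} (x : (treeOperad TriOp).obj n) :
    (ComTrias k).obj n :=
  Submodule.Quotient.mk ((treeOperad TriOp).basisElt k x)

theorem comTriasMk_map (k : Type u) [CommRing k] {m n : ℕ} (σ : Fin m ≃ Fin n)
    (x : (treeOperad TriOp).obj m) :
    comTriasMk k ((treeOperad TriOp).map σ x) = (ComTrias k).map σ (comTriasMk k x) :=
  congrArg Submodule.Quotient.mk ((treeOperad TriOp).map_basisElt k σ x).symm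

theorem comTriasMk_comp (k : Type u) [CommRing k] {t : ℕ} (i : Fin t → ℕ)
    (x : (treeOperad TriOp).obj t) (y : ∀ j, (treeOperad TriOp).obj (i j)) :
    comTriasMk k ((treeOperad TriOp).comp i x y) =
      (ComTrias k).comp i (comTriasMk k x) (fun j => comTriasMk k (y j)) :=
  (congrArg (fun p : (freeTriOperad k).obj _ => (Submodule.Quotient.mk p : (ComTrias k).obj _))
    ((treeOperad TriOp).comp_basisElt k i x y).symm).trans
    (AlgOperad.quotientComp_mk (freeTriOperad k) _ i _ _).symm

theorem subset_idealSpan {k : Type u} [CommRing k] {P : AlgOperad.{u, v} k}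
    (R : ∀ n, Set (P.obj n)) {n : ℕ} {p : P.obj n} (hp : p ∈ R n) :
    p ∈ (P.idealSpan R).carrier n := by
  simp only [AlgOperad.idealSpan, Submodule.mem_iInf]
  exact fun J hJ => hJ n hp

theorem comTriasMk_eq_of_rel (k : Type u) [CommRing k] {n : ℕ} {x y : (treeOperad TriOp).obj n}
    (h : ComTriasRel n x.1 y.1) : comTriasMk k x = comTriasMk k y :=
  (Submodule.Quotient.eq _).2 (subset_idealSpan _ ⟨x, y, h, rfl⟩)

theorem ComTriasRel.isMultilinear {n : ℕ} {x y : BinTree TriOp (Fin n)}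
    (h : ComTriasRel n x y) : x.IsMultilinear ∧ y.IsMultilinear := by
  cases h <;> constructor <;>
    simp only [BinTree.IsMultilinear, BinTree.star, BinTree.bullet, BinTree.leaves] <;> decide

namespace BinTree

/-- Two trees with arbitrary labels are identified if they carry the same labels and if, unless
some label is repeated, they are obtained by the same relabelling from two multilinear trees giving
the same operation of `ComTrias`. -/
def Identified (k : Type u) [CommRing k] {α : Type} (x y : BinTree TriOp α) : Prop :=
  x.leaves.Perm y.leaves ∧ (x.leaves.Nodup →
    ∃ (n : ℕ) (f : Fin n → α) (x' y' : (treeOperad TriOp).obj n),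
      map f x'.1 = x ∧ map f y'.1 = y ∧ comTriasMk k x' = comTriasMk k y')

namespace Identified

variable {k : Type u} [CommRing k] {α : Type}

theorem refl (x : BinTree TriOp α) : Identified k x x := by
  refine ⟨.refl _, fun hx => ?_⟩
  obtain ⟨n, f, y, h⟩ := exists_treeOperad_map_eq hx
  exact ⟨n, f, y, y, h, h, rfl⟩

theorem symm {x y : BinTree TriOp α} (h : Identified k x y) : Identified k y x := by
  refine ⟨h.1.symm, fun hy => ?_⟩
  obtain ⟨n, f, x', y', hx', hy', e⟩ := h.2 (h.1.nodup_iff.2 hy)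
  exact ⟨n, f, y', x', hy', hx', e.symm⟩

theorem trans {x y z : BinTree TriOp α} (hxy : Identified k x y) (hyz : Identified k y z) :
    Identified k x z := by
  refine ⟨hxy.1.trans hyz.1, fun hx => ?_⟩
  have hy := hxy.1.nodup_iff.1 hx
  obtain ⟨m, f, x', y', rfl, hy', e⟩ := hxy.2 hx
  obtain ⟨n, g, y'', z', hy'', rfl, e'⟩ := hyz.2 hy
  have hf : Function.Injective f := x'.2.injective_of_nodup hx
  have hg : Function.Injective g := y''.2.injective_of_nodup (hy'' ▸ hy)
  have hfg : Set.range g = Set.range f := by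
    ext b
    rw [← y''.2.mem_leaves_map, hy'', ← hy', y'.2.mem_leaves_map]
  -- the two standardizations of `y` differ by a bijection of the labels
  let σ : Fin n ≃ Fin m :=
    (Equiv.ofInjective g hg).trans ((Equiv.setCongr hfg).trans (Equiv.ofInjective f hf).symm)
  have hσ (a : Fin n) : f (σ a) = g a := by
    simp only [σ, Equiv.trans_apply, Equiv.apply_ofInjective_symm]
    rfl
  have hmap (w : (treeOperad TriOp).obj n) :
      map f ((treeOperad TriOp).map σ w).1 = map g w.1 := by
    change map f (map σ w.1) = map g w.1
    simp only [map_map, hσ]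
  refine ⟨m, f, x', (treeOperad TriOp).map σ z', rfl, hmap z', ?_⟩
  have h : y' = (treeOperad TriOp).map σ y'' :=
    Subtype.ext (map_injective hf (by rw [hmap, hy', hy'']))
  rw [e, h, comTriasMk_map, e', comTriasMk_map]

theorem bind_congr {t : ℕ} (p : (treeOperad TriOp).obj t) {x y : Fin t → BinTree TriOp α}
    (h : ∀ j, Identified k (x j) (y j)) : Identified k (bind x p.1) (bind y p.1) := by
  refine ⟨?_, fun hx => ?_⟩
  · rw [leaves_bind, leaves_bind]
    exact List.Perm.flatMap_left _ fun j _ => (h j).1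
  · rw [leaves_bind, List.nodup_flatMap] at hx
    choose i f x' y' hx' hy' e using fun j => (h j).2 (hx.1 j (p.2.2 j))
    refine ⟨_, _, (treeOperad TriOp).comp i p x', (treeOperad TriOp).comp i p y',
      (bind_map_eq_map_graft p.1 (fun j => (x' j).1) f).symm.trans ?_,
      (bind_map_eq_map_graft p.1 (fun j => (y' j).1) f).symm.trans ?_, ?_⟩
    · simp only [hx']
    · simp only [hy']
    · simp only [comTriasMk_comp, e]

theorem node_congr (g : TriOp) {x₁ x₂ y₁ y₂ : BinTree TriOp α} (h₁ : Identified k x₁ y₁)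
    (h₂ : Identified k x₂ y₂) : Identified k (node g x₁ x₂) (node g y₁ y₂) :=
  bind_congr (triCorolla g) (x := ![x₁, x₂]) (y := ![y₁, y₂]) fun j => by
    fin_cases j
    · exact h₁
    · exact h₂

/-- The substitution instances of the defining identities of commutative trialgebras. -/
theorem of_rel {t : ℕ} {p q : BinTree TriOp (Fin t)} (h : ComTriasRel t p q)
    (x : Fin t → BinTree TriOp α) : Identified k (bind x p) (bind x q) := by
  obtain ⟨hp, hq⟩ := h.isMultilinear
  have hpq : p.leaves.Perm q.leaves :=
    (List.perm_ext_iff_of_nodup hp.1 hq.1).2 fun a => by simp [hp.2 a, hq.2 a]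
  refine ⟨?_, fun hx => ?_⟩
  · rw [leaves_bind, leaves_bind]
    exact hpq.flatMap_right _
  · rw [leaves_bind, List.nodup_flatMap] at hx
    choose i f x' hx' using fun j => exists_treeOperad_map_eq (hx.1 j (hp.2 j))
    refine ⟨_, _, (treeOperad TriOp).comp i ⟨p, hp⟩ x', (treeOperad TriOp).comp i ⟨q, hq⟩ x',
      (bind_map_eq_map_graft p (fun j => (x' j).1) f).symm.trans ?_,
      (bind_map_eq_map_graft q (fun j => (x' j).1) f).symm.trans ?_, ?_⟩
    · simp only [hx']
    · simp only [hx']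
    · have e := comTriasMk_eq_of_rel k (x := ⟨p, hp⟩) (y := ⟨q, hq⟩) h
      exact (comTriasMk_comp k i _ x').trans
        ((congrArg (fun r => (ComTrias k).comp i r _) e).trans (comTriasMk_comp k i _ x').symm)

theorem comTriasMk_eq {n : ℕ} {x y : (treeOperad TriOp).obj n} (h : Identified k x.1 y.1) :
    comTriasMk k x = comTriasMk k y := by
  obtain ⟨m, f, x', y', hx, hy, e⟩ := h.2 x.2.1
  have hf : Function.Bijective f := by
    refine ⟨x'.2.injective_of_nodup (hx ▸ x.2.1), fun a => ?_⟩
    rw [← Set.mem_range, ← x'.2.mem_leaves_map, hx]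
    exact x.2.2 a
  have hx : x = (treeOperad TriOp).map (Equiv.ofBijective f hf) x' := Subtype.ext hx.symm
  have hy : y = (treeOperad TriOp).map (Equiv.ofBijective f hf) y' := Subtype.ext hy.symm
  rw [hx, hy, comTriasMk_map, e, comTriasMk_map]

variable (k α) in
/-- Identification as an equivalence relation. -/
def setoid : Setoid (BinTree TriOp α) := ⟨Identified k, refl, symm, trans⟩

variable (k α) in
/-- The trees up to identification, a commutative trialgebra generated by `α`. -/
abbrev Class : Type := Quotient (setoid k α)

instance : ComTrialgebra (Class k α) where
  mul := Quotient.map₂ bullet fun _ _ h₁ _ _ h₂ => node_congr .bullet h₁ h₂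
  starMul := Quotient.map₂ BinTree.star fun _ _ h₁ _ _ h₂ => node_congr .star h₁ h₂
  mul_assoc := by
    rintro ⟨x⟩ ⟨y⟩ ⟨z⟩
    exact Quotient.sound (of_rel .bullet_assoc ![x, y, z])
  mul_comm := by
    rintro ⟨x⟩ ⟨y⟩
    exact Quotient.sound (of_rel .bullet_comm ![x, y])
  starMul_assoc := by
    rintro ⟨x⟩ ⟨y⟩ ⟨z⟩
    exact Quotient.sound (of_rel .star_assoc ![x, y, z])
  starMul_perm := by
    rintro ⟨x⟩ ⟨y⟩ ⟨z⟩
    exact Quotient.sound (of_rel .star_perm ![x, y, z])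
  starMul_mul := by
    rintro ⟨x⟩ ⟨y⟩ ⟨z⟩
    exact Quotient.sound (of_rel .star_bullet ![x, y, z])
  mul_starMul := by
    rintro ⟨x⟩ ⟨y⟩ ⟨z⟩
    exact Quotient.sound (of_rel .bullet_star ![x, y, z])

theorem eval_class (x : BinTree TriOp α) :
    eval (fun a => (Quotient.mk (setoid k α) (leaf a) : Class k α)) x =
      Quotient.mk (setoid k α) x := by
  induction x with
  | leaf a => rfl
  | node g x y hx hy => cases g <;> rw [eval, hx, hy] <;> rfl

end Identified

end BinTree

/-- Trees with the same support give the same operation of `ComTrias`. -/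
theorem comTriasMk_eq_of_suppHom_eq (k : Type u) [CommRing k] {n : ℕ}
    {x y : (treeOperad TriOp).obj n} (h : suppHom.app n x = suppHom.app n y) :
    comTriasMk k x = comTriasMk k y := by
  refine BinTree.Identified.comTriasMk_eq (Quotient.exact (s := BinTree.Identified.setoid k _) ?_)
  rw [← BinTree.Identified.eval_class, ← BinTree.Identified.eval_class]
  exact BinTree.eval_eq_eval_of_isMultilinear _ x.2 y.2 (congrArg Subtype.val h)

/-! ### The isomorphism -/

theorem idealSpan_le_ker (k : Type u) [CommRing k] (n : ℕ) :
    (((treeOperad TriOp).linearize k).idealSpan (comTriasRelators k)).carrier n ≤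
      LinearMap.ker (suppHom.lin k n) := by
  refine iInf₂_le (suppHom.ker k) ?_
  rintro n _ ⟨x, y, h, rfl⟩
  refine LinearMap.mem_ker.2 ((map_sub (suppHom.lin k n) _ _).trans ?_)
  rw [SetOperad.Hom.lin_basisElt, SetOperad.Hom.lin_basisElt, sub_eq_zero]
  refine congrArg _ (Subtype.ext ?_)
  change x.1.supp.toFinset = y.1.supp.toFinset
  generalize x.1 = x at h
  generalize y.1 = y at h
  cases h <;> decide

/-- The linear map from `ComTrias` in arity `n` to the free module on the nonempty subsets of
`Fin n` induced by the support of trees. -/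
noncomputable def comTriasToSubsets (k : Type u) [CommRing k] (n : ℕ) :
    (ComTrias k).obj n →ₗ[k] (comTriasSet.linearize k).obj n :=
  Submodule.liftQ ((((treeOperad TriOp).linearize k).idealSpan (comTriasRelators k)).carrier n)
    (suppHom.lin k n) (idealSpan_le_ker k n)

theorem comTriasToSubsets_mk (k : Type u) [CommRing k] {n : ℕ} (x : (treeOperad TriOp).obj n) :
    comTriasToSubsets k n (comTriasMk k x) = comTriasSet.basisElt k (suppHom.app n x) :=
  suppHom.lin_basisElt k x

/-- The inverse map, sending `e_J` to the operation given by any tree with support `J`. -/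
noncomputable def subsetsToComTrias (k : Type u) [CommRing k] (n : ℕ) :
    (comTriasSet.linearize k).obj n →ₗ[k] (ComTrias k).obj n :=
  Finsupp.linearCombination k fun J : comTriasSet.obj n =>
    comTriasMk k (Function.surjInv (suppHom_app_surjective n) J)

theorem subsetsToComTrias_basisElt (k : Type u) [CommRing k] {n : ℕ} (J : comTriasSet.obj n) :
    subsetsToComTrias k n (comTriasSet.basisElt k J) =
      comTriasMk k (Function.surjInv (suppHom_app_surjective n) J) :=
  (Finsupp.linearCombination_single k 1 J).trans (one_smul k _)

/-- The linear isomorphism of `ComTrias n` with the free module on the nonempty subsets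
of `Fin n`. -/
noncomputable def comTriasEquiv (k : Type u) [CommRing k] (n : ℕ) :
    (ComTrias k).obj n ≃ₗ[k] (comTriasSet.linearize k).obj n :=
  LinearEquiv.ofLinearMap (comTriasToSubsets k n) (subsetsToComTrias k n)
    (Finsupp.lhom_ext' fun J => LinearMap.ext_ring <| by
      change comTriasToSubsets k n (subsetsToComTrias k n (comTriasSet.basisElt k J)) =
        comTriasSet.basisElt k J
      rw [subsetsToComTrias_basisElt, comTriasToSubsets_mk,
        Function.surjInv_eq (suppHom_app_surjective n)])
    (Submodule.linearMap_qext _ <| Finsupp.lhom_ext' fun x => LinearMap.ext_ring <| by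
      change subsetsToComTrias k n (comTriasToSubsets k n (comTriasMk k x)) = comTriasMk k x
      rw [comTriasToSubsets_mk, subsetsToComTrias_basisElt]
      exact comTriasMk_eq_of_suppHom_eq k (Function.surjInv_eq _ _))

/-- The isomorphism of operads between `ComTrias` and the linearization of the set operad of
nonempty subsets. -/
noncomputable def comTriasIso (k : Type u) [CommRing k] :
    (ComTrias k).Iso (comTriasSet.linearize k) where
  equiv := comTriasEquiv k
  equiv_map σ p := by
    obtain ⟨p, rfl⟩ := Submodule.Quotient.mk_surjective _ p
    exact suppHom.lin_map k σ p
  equiv_one := (comTriasToSubsets_mk k _).trans (congrArg _ suppHom.app_one)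
  equiv_comp i p q := by
    obtain ⟨p, rfl⟩ := Submodule.Quotient.mk_surjective _ p
    choose q' hq using fun j => Submodule.Quotient.mk_surjective _ (q j)
    obtain rfl : (fun j => Submodule.Quotient.mk (q' j)) = q := funext hq
    exact (congrArg (comTriasEquiv k _) (AlgOperad.quotientComp_mk _ _ i p q')).trans
      (suppHom.lin_comp k i p q')

theorem comTriasSet_isBasic : comTriasSet.IsBasic := by
  intro t i K J J' h
  have h : blockUnion J.1 (fun j => (K j).1) = blockUnion J'.1 (fun j => (K j).1) :=
    congrArg Subtype.val h
  refine Subtype.ext (Finset.ext fun j => ?_)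
  -- an element of `K j` detects whether `j` belongs to `J`
  obtain ⟨a, ha⟩ := (K j).2
  have h' := congrArg (finSigmaFinEquiv ⟨j, a⟩ ∈ ·) h
  simpa only [mem_blockUnion, ha, and_true, eq_iff_iff] using h'

/-- The operad `ComTrias` is isomorphic to the linearization of the set operad of nonempty subsets;
the isomorphism is given with the symmetric group action and the composition spelled out, and the
set operad is basic-set. -/
theorem mainTheorem9 (k : Type*) [CommRing k] :
    (∃ φ : (ComTrias k).Iso (comTriasSet.linearize k),
      -- the generators `⋆` and `•` correspond to `e_{1}` and `e_{1,2}`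
      φ.equiv 2 (comTriasGen k TriOp.star) = subsetElt k {0} (Finset.singleton_nonempty 0) ∧
      φ.equiv 2 (comTriasGen k TriOp.bullet) =
        subsetElt k {0, 1} (Finset.insert_nonempty 0 {1}) ∧
      -- the symmetric group acts on the basis through its action on subsets
      (∀ (n : ℕ) (σ : Equiv.Perm (Fin n)) (J : Finset (Fin n)) (hJ : J.Nonempty),
        (ComTrias k).map σ ((φ.equiv n).symm (subsetElt k J hJ)) =
          (φ.equiv n).symm (subsetElt k (J.image σ) (hJ.image σ))) ∧
      -- the composition formula
      (∀ (t : ℕ) (i : Fin t → ℕ) (J : Finset (Fin t)) (hJ : J.Nonempty)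
        (K : ∀ j, Finset (Fin (i j))) (hK : ∀ j, (K j).Nonempty),
        ∃ (L : Finset (Fin (∑ j, i j))) (hL : L.Nonempty),
          (∀ b : Fin (∑ j, i j), b ∈ L ↔ ∃ j ∈ J, ∃ a ∈ K j,
            (b : ℕ) = (∑ l ∈ Finset.univ.filter (· < j), i l) + (a : ℕ)) ∧
          (ComTrias k).comp i ((φ.equiv t).symm (subsetElt k J hJ))
              (fun j => (φ.equiv (i j)).symm (subsetElt k (K j) (hK j))) =
            (φ.equiv (∑ j, i j)).symm (subsetElt k L hL))) ∧
    comTriasSet.IsBasic := by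
  refine ⟨⟨comTriasIso k, ?_, ?_, fun n σ J hJ => ?_, fun t i J hJ K hK => ?_⟩,
    comTriasSet_isBasic⟩
  · exact (comTriasToSubsets_mk k (triCorolla .star)).trans (congrArg _ (Subtype.ext rfl))
  · exact (comTriasToSubsets_mk k (triCorolla .bullet)).trans (congrArg _ (Subtype.ext rfl))
  · rw [LinearEquiv.eq_symm_apply, AlgOperad.Iso.equiv_map, LinearEquiv.apply_symm_apply]
    refine (comTriasSet.map_basisElt k σ _).trans (congrArg _ (Subtype.ext ?_))
    exact Finset.map_eq_image _ _
  · let L : comTriasSet.obj (∑ j, i j) :=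
      comTriasSet.comp i ⟨J, hJ⟩ (fun j => ⟨K j, hK j⟩)
    refine ⟨L.1, L.2, fun b => ?_, ?_⟩
    · change b ∈ blockUnion J K ↔ _
      simp only [blockUnion, Finset.mem_biUnion, Finset.mem_image, ← val_finSigmaFinEquiv,
        Fin.ext_iff, eq_comm]
    · rw [LinearEquiv.eq_symm_apply, AlgOperad.Iso.equiv_comp]
      simp only [LinearEquiv.apply_symm_apply]
      exact comTriasSet.comp_basisElt k i _ _
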